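/- Let $r,s,t\in\mathbb C$ be such that $0,1,r,s,t$ are pairwise distinct, and let $X$ be the smooth complex projective curve of genus $2$ with affine equation $y^2=x(x-1)(x-r)(x-s)(x-t)$. A trace-free connection on the trivial bundle $E=\mathcal O_X\oplus\mathcal O_X$ is a holomorphic connection $\nabla=\mathrm d+\theta$, where $\theta=\begin{pmatrix}\alpha&\beta\\ \gamma&-\alpha\end{pmatrix}$ with $\alpha,\beta,\gamma\in \mathrm H^0(X,\Omega^1_X)$; it is irreducible if no line subbundle of $E$ is $\nabla$-invariant, and two connections are isomorphic if an automorphism of $E$ carries one to the other. Let $\mathcal M$ be the moduli space of irreducible trace-free connections on $E$: its points are the isomorphism classes, and its Zariski topology and regular functions are those of the quotient, i.e. a subset of $\mathcal M$ is open, respectively a function on an open subset of $\mathcal M$ is regular, if and only if its pull-back to the space of irreducible trace-free connections $\mathrm d+\theta$ on $E$ (a subvariety of the vector space of $2\times 2$ matrices over $\mathrm H^0(X,\Omega^1_X)$) is open, respectively regular. Let $$U=\{q\in \mathrm H^0(X,\Omega^1_X\otimes\Omega^1_X)\;:\; q\neq\omega\otimes\omega\text{ for all }\omega\in \mathrm H^0(X,\Omega^1_X)\}.$$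 Then $U$ is a Zariski open subset of the vector space $\mathrm H^0(X,\Omega^1_X\otimes\Omega^1_X)$, and the map $\mathrm d+\theta\mapsto\det\theta=-(\alpha\otimes\alpha+\beta\otimes\gamma)$ induces an isomorphism $\mathcal M\to U$, that is, a bijection which is a homeomorphism for the Zariski topologies and identifies the regular functions on each open subset of $U$ with the regular functions on the corresponding open subset of $\mathcal M$. -/

import Mathlib

open scoped TensorProduct

noncomputable section

namespace GenusTwo

/-! ### The curve

`X` is the smooth complex projective curve with affine equation
`y² = x (x - 1) (x - r) (x - s) (x - t)`. It is the union of the two affine charts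
`Spec ℂ[x, y]` and `Spec ℂ[1/x, y/x³]`, whose coordinate rings are subrings of the function
field `ℂ(X)`. All sheaves below are torsion free, so that their sections over a chart, or over `X`,
are elements of the generic stalk. -/

/-- The polynomial `x (x - 1) (x - r) (x - s) (x - t)`. -/
def quintic (r s t : ℂ) : Polynomial ℂ :=
  Polynomial.X * (Polynomial.X - Polynomial.C 1) * (Polynomial.X - Polynomial.C r) *
    (Polynomial.X - Polynomial.C s) * (Polynomial.X - Polynomial.C t)

/-- The polynomial `Y² - x (x - 1) (x - r) (x - s) (x - t)` in `Y` over `ℂ(x)`. -/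
def definingPoly (r s t : ℂ) : Polynomial (RatFunc ℂ) :=
  Polynomial.X ^ 2 - Polynomial.C (algebraMap (Polynomial ℂ) (RatFunc ℂ) (quintic r s t))

theorem quintic_natDegree (r s t : ℂ) : (quintic r s t).natDegree = 5 := by
  unfold quintic
  compute_degree!

theorem definingPoly_irreducible (r s t : ℂ) : Irreducible (definingPoly r s t) := by
  refine X_pow_sub_C_irreducible_of_prime Nat.prime_two ?_
  intro b hb
  have hq : quintic r s t ≠ 0 := by
    intro h
    have := quintic_natDegree r s t
    rw [h] at this
    simp at this
  have hb0 : b ≠ 0 := by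
    rintro rfl
    have h0 : algebraMap (Polynomial ℂ) (RatFunc ℂ) (quintic r s t) = 0 := by
      rw [← hb]; simp
    exact hq ((map_eq_zero_iff _ (RatFunc.algebraMap_injective ℂ)).1 h0)
  have h1 := congrArg RatFunc.intDegree hb
  rw [pow_two, RatFunc.intDegree_mul hb0 hb0, RatFunc.intDegree_polynomial,
    quintic_natDegree] at h1
  omega

instance definingPoly_fact (r s t : ℂ) : Fact (Irreducible (definingPoly r s t)) :=
  ⟨definingPoly_irreducible r s t⟩

/-- The function field `ℂ(X) = ℂ(x)[y] / (y² - x (x - 1) (x - r) (x - s) (x - t))`. -/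
def FunctionField (r s t : ℂ) : Type := AdjoinRoot (definingPoly r s t)

instance (r s t : ℂ) : Field (FunctionField r s t) :=
  inferInstanceAs (Field (AdjoinRoot (definingPoly r s t)))

instance (r s t : ℂ) : Algebra ℂ (FunctionField r s t) :=
  inferInstanceAs (Algebra ℂ (AdjoinRoot (definingPoly r s t)))

/-- The coordinate function `x`. -/
def coordX (r s t : ℂ) : FunctionField r s t :=
  AdjoinRoot.of (definingPoly r s t) RatFunc.X

/-- The coordinate function `y`. -/
def coordY (r s t : ℂ) : FunctionField r s t :=
  AdjoinRoot.root (definingPoly r s t)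

/-- The coordinate rings `ℂ[x, y]` and `ℂ[1/x, y/x³]` of the two affine charts covering `X`. -/
def chart (r s t : ℂ) : Fin 2 → Subalgebra ℂ (FunctionField r s t)
  | 0 => Algebra.adjoin ℂ {coordX r s t, coordY r s t}
  | 1 => Algebra.adjoin ℂ {(coordX r s t)⁻¹, coordY r s t * (coordX r s t)⁻¹ ^ 3}

/-! ### Differentials

In the rest of the file `K` is the function field of a smooth curve `X` and `A 0`, `A 1` are the
coordinate rings of two affine charts covering `X`, as for `A = chart r s t` above. -/

/-- Rational (meromorphic) `1`-forms on `X`. -/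
abbrev RatForm (K : Type) [Field K] [Algebra ℂ K] : Type := Ω[K⁄ℂ]

/-- Rational quadratic differentials on `X`. -/
abbrev RatQuad (K : Type) [Field K] [Algebra ℂ K] : Type :=
  RatForm K ⊗[K] RatForm K

/-- The sections of `Ω¹` over a chart `Spec R`: the image of `Ω_R` in `Ω_{ℂ(X)}`. -/
def chartForms {K : Type} [Field K] [Algebra ℂ K] (A : Fin 2 → Subalgebra ℂ K) (c : Fin 2) :
    Submodule ℂ (RatForm K) :=
  (LinearMap.range (KaehlerDifferential.map ℂ ℂ (A c)
    K)).restrictScalars ℂ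

/-- The sections of `Ω¹ ⊗ Ω¹` over a chart `Spec R`: the image of `Ω_R ⊗_R Ω_R`. -/
def chartQuads {K : Type} [Field K] [Algebra ℂ K] (A : Fin 2 → Subalgebra ℂ K) (c : Fin 2) :
    Submodule ℂ (RatQuad K) :=
  Submodule.span ℂ {q | ∃ ω ∈ chartForms A c, ∃ η ∈ chartForms A c,
    q = ω ⊗ₜ[K] η}

/-- `H⁰(X, Ω¹)`. -/
def HolForm {K : Type} [Field K] [Algebra ℂ K] (A : Fin 2 → Subalgebra ℂ K) :
    Submodule ℂ (RatForm K) := ⨅ c, chartForms A c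

/-- `H⁰(X, Ω¹ ⊗ Ω¹)`. -/
def HolQuad {K : Type} [Field K] [Algebra ℂ K] (A : Fin 2 → Subalgebra ℂ K) :
    Submodule ℂ (RatQuad K) := ⨅ c, chartQuads A c

/-- The tensor product of two holomorphic `1`-forms. -/
def HolForm.tmul {K : Type} [Field K] [Algebra ℂ K] {A : Fin 2 → Subalgebra ℂ K} (ω η : HolForm A) : HolQuad A :=
  ⟨(ω : RatForm K) ⊗ₜ[K] (η : RatForm K), by
    refine (Submodule.mem_iInf _).2 fun c => Submodule.subset_span ?_
    exact ⟨ω, (Submodule.mem_iInf _).1 ω.2 c, η, (Submodule.mem_iInf _).1 η.2 c, rfl⟩⟩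

/-- The quadratic differentials that are not the square `ω ⊗ ω` of a holomorphic `1`-form. -/
def nonSquares {K : Type} [Field K] [Algebra ℂ K] (A : Fin 2 → Subalgebra ℂ K) : Set (HolQuad A) :=
  {q | ¬ ∃ ω : HolForm A, q = HolForm.tmul ω ω}

/-! ### Connections on the trivial bundle `E = 𝒪 ⊕ 𝒪` -/

/-- A section of `E` over a chart, as an element of the generic stalk `ℂ(X)²`. -/
def IsSection {K : Type} [Field K] [Algebra ℂ K] (A : Fin 2 → Subalgebra ℂ K) (c : Fin 2) (v : Fin 2 → K) :
    Prop :=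
  ∀ i, v i ∈ A c

/-- A holomorphic connection `∇ : E → E ⊗ Ω¹` on `E = 𝒪 ⊕ 𝒪`: a `ℂ`-linear map satisfying the
Leibniz rule (given on the generic stalk) which maps sections of `E` over each chart to sections of
`E ⊗ Ω¹ = Ω¹ ⊕ Ω¹` over that chart. -/
structure Connection {K : Type} [Field K] [Algebra ℂ K] (A : Fin 2 → Subalgebra ℂ K) where
  toMap : (Fin 2 → K) →ₗ[ℂ] (Fin 2 → RatForm K)
  leibniz : ∀ (g : K) (v : Fin 2 → K),
    toMap (g • v) = g • toMap v + fun i => v i • KaehlerDifferential.D ℂ K g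
  regular : ∀ (c : Fin 2) (v : Fin 2 → K), IsSection A c v →
    ∀ i, toMap v i ∈ chartForms A c

/-- The matrix `θ` of holomorphic `1`-forms with `∇ = d + θ`; its `j`-th column is `∇ e_j`. -/
def Connection.form {K : Type} [Field K] [Algebra ℂ K] {A : Fin 2 → Subalgebra ℂ K} (D : Connection A) :
    Matrix (Fin 2) (Fin 2) (HolForm A) := fun i j =>
  ⟨D.toMap (Pi.single j 1) i, (Submodule.mem_iInf _).2 fun c => D.regular c _ (by
    intro k
    by_cases h : k = j
    · subst h
      simp
    · simp [Pi.single_eq_of_ne h]) i⟩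

/-- The connection `tr ∇` on `det E = 𝒪`, which is `d + tr θ`, is the trivial connection `d`. -/
def Connection.TraceFree {K : Type} [Field K] [Algebra ℂ K] {A : Fin 2 → Subalgebra ℂ K} (D : Connection A) :
    Prop := D.form.trace = 0

/-- `det θ ∈ H⁰(X, Ω¹ ⊗ Ω¹)`. -/
def Connection.det {K : Type} [Field K] [Algebra ℂ K] {A : Fin 2 → Subalgebra ℂ K} (D : Connection A) : HolQuad A :=
  HolForm.tmul (D.form 0 0) (D.form 1 1) - HolForm.tmul (D.form 0 1) (D.form 1 0)

/-- A line subbundle `L` of `E` is given by its generic stalk, a line `ℓ` in `ℂ(X)²`; its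
sections over a chart are the sections of `E` lying in `ℓ`. It is invariant if
`∇ L ⊆ L ⊗ Ω¹` over each chart. -/
def Connection.Invariant {K : Type} [Field K] [Algebra ℂ K] {A : Fin 2 → Subalgebra ℂ K} (D : Connection A)
    (l : Submodule K (Fin 2 → K)) : Prop :=
  ∀ (c : Fin 2), ∀ v ∈ l, IsSection A c v →
    D.toMap v ∈ Submodule.span ℂ {z : Fin 2 → RatForm K |
      ∃ w ∈ l, IsSection A c w ∧ ∃ ω ∈ chartForms A c, z = fun i => w i • ω}

/-- There is no invariant line subbundle. -/
def Connection.Irreducible {K : Type} [Field K] [Algebra ℂ K] {A : Fin 2 → Subalgebra ℂ K} (D : Connection A) :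
    Prop :=
  ¬ ∃ l : Submodule K (Fin 2 → K),
    Module.finrank K l = 1 ∧ D.Invariant l

/-- The automorphisms of the bundle `E`: invertible matrices `g` of rational functions such
that `g` and `g⁻¹` preserve the sections of `E` over each chart. -/
def bundleAut {K : Type} [Field K] [Algebra ℂ K] (A : Fin 2 → Subalgebra ℂ K) : Subgroup (GL (Fin 2) K) where
  carrier := {g | ∀ (c : Fin 2) (v : Fin 2 → K),
    IsSection A c ((g : Matrix (Fin 2) (Fin 2) K).mulVec v) ↔ IsSection A c v}
  mul_mem' := by
    intro a b ha hb c v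
    rw [Units.val_mul, ← Matrix.mulVec_mulVec, ha, hb]
  one_mem' := by
    intro c v
    simp
  inv_mem' := by
    intro a ha c v
    rw [← ha c, Matrix.mulVec_mulVec, ← Units.val_mul]
    simp

/-- The action `g ⊗ id` of a matrix `g` of rational functions on `E ⊗ Ω¹`. -/
def formAct {K : Type} [Field K] [Algebra ℂ K]
    (g : Matrix (Fin 2) (Fin 2) K)
    (z : Fin 2 → RatForm K) : Fin 2 → RatForm K :=
  fun i => ∑ j, g i j • z j

theorem formAct_one {K : Type} [Field K] [Algebra ℂ K]
    (z : Fin 2 → RatForm K) : formAct 1 z = z := by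
  funext i
  simp [formAct, Matrix.one_apply]

theorem formAct_mul {K : Type} [Field K] [Algebra ℂ K]
    (g h : Matrix (Fin 2) (Fin 2) K)
    (z : Fin 2 → RatForm K) : formAct (g * h) z = formAct g (formAct h z) := by
  funext i
  simp only [formAct, Matrix.mul_apply, Finset.sum_smul, Finset.smul_sum, mul_smul]
  exact Finset.sum_comm

/-- Two connections on `E` are isomorphic if an automorphism of `E` carries one to the other. -/
def Connection.Isomorphic {K : Type} [Field K] [Algebra ℂ K] {A : Fin 2 → Subalgebra ℂ K} (D D' : Connection A) :
    Prop :=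
  ∃ g ∈ bundleAut A, ∀ v : Fin 2 → K,
    D'.toMap ((g : Matrix (Fin 2) (Fin 2) K).mulVec v) =
      formAct (g : Matrix (Fin 2) (Fin 2) K) (D.toMap v)

/-- The irreducible trace-free connections on `E`. -/
def IrrConnection {K : Type} [Field K] [Algebra ℂ K] (A : Fin 2 → Subalgebra ℂ K) : Type :=
  {D : Connection A // D.TraceFree ∧ D.Irreducible}

/-- Isomorphism of irreducible trace-free connections on `E`. -/
def isoSetoid {K : Type} [Field K] [Algebra ℂ K] (A : Fin 2 → Subalgebra ℂ K) : Setoid (IrrConnection A) where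
  r D D' := D.1.Isomorphic D'.1
  iseqv :=
    { refl := fun D => ⟨1, one_mem _, fun v => by simp [formAct_one]⟩
      symm := by
        rintro D D' ⟨g, hg, h⟩
        refine ⟨g⁻¹, inv_mem hg, fun v => ?_⟩
        have h1 := h (((g⁻¹ : GL (Fin 2) K) :
          Matrix (Fin 2) (Fin 2) K).mulVec v)
        rw [Matrix.mulVec_mulVec, ← Units.val_mul, mul_inv_cancel, Units.val_one,
          Matrix.one_mulVec] at h1
        rw [h1, ← formAct_mul, ← Units.val_mul, inv_mul_cancel, Units.val_one, formAct_one]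
      trans := by
        rintro D D' D'' ⟨g, hg, h⟩ ⟨g', hg', h'⟩
        refine ⟨g' * g, mul_mem hg' hg, fun v => ?_⟩
        rw [Units.val_mul, ← Matrix.mulVec_mulVec, h', h, formAct_mul] }

/-- The set of isomorphism classes of irreducible trace-free connections on `E`. -/
def Moduli {K : Type} [Field K] [Algebra ℂ K] (A : Fin 2 → Subalgebra ℂ K) : Type := Quotient (isoSetoid A)

/-- The isomorphism class of a connection. -/
def Moduli.mk {K : Type} [Field K] [Algebra ℂ K] {A : Fin 2 → Subalgebra ℂ K} (D : IrrConnection A) : Moduli A :=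
  Quotient.mk (isoSetoid A) D

/-! ### Algebraic structure -/

/-- The algebra of polynomial functions on a complex vector space. -/
def polyFun (V : Type*) [AddCommGroup V] [Module ℂ V] : Subalgebra ℂ (V → ℂ) :=
  Algebra.adjoin ℂ (Set.range fun φ : Module.Dual ℂ V => (φ : V → ℂ))

/-- The Zariski topology of a complex vector space. -/
@[reducible] def zariski (V : Type*) [AddCommGroup V] [Module ℂ V] : TopologicalSpace V :=
  TopologicalSpace.generateFrom {U | ∃ p ∈ polyFun V, U = {v | p v ≠ 0}}

/-- Regular functions on an open subset `O` of a space `S` embedded by `e` in a complex vector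
space: functions that are locally on `O` quotients of polynomials. (Only the values of `f` on `O`
matter.) -/
def IsRegularOn {S V : Type*} [AddCommGroup V] [Module ℂ V] (e : S → V) (O : Set S)
    (f : S → ℂ) : Prop :=
  ∀ a ∈ O, ∃ p ∈ polyFun V, ∃ q ∈ polyFun V, q (e a) ≠ 0 ∧
    ∀ b ∈ O, q (e b) ≠ 0 → f b = p (e b) / q (e b)

/-- The Zariski topology of `H⁰(X, Ω¹ ⊗ Ω¹)`. -/
instance {K : Type} [Field K] [Algebra ℂ K] (A : Fin 2 → Subalgebra ℂ K) : TopologicalSpace (HolQuad A) := zariski _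

/-- The space of irreducible trace-free connections is a locally closed subset of the vector space
of matrices of holomorphic `1`-forms, through `d + θ ↦ θ`. -/
def IrrConnection.form {K : Type} [Field K] [Algebra ℂ K] {A : Fin 2 → Subalgebra ℂ K} (D : IrrConnection A) :
    Matrix (Fin 2) (Fin 2) (HolForm A) := D.1.form

/-- The Zariski topology of the space of irreducible trace-free connections. -/
instance {K : Type} [Field K] [Algebra ℂ K] (A : Fin 2 → Subalgebra ℂ K) : TopologicalSpace (IrrConnection A) :=
  (zariski (Matrix (Fin 2) (Fin 2) (HolForm A))).induced IrrConnection.form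

/-- The moduli space carries the quotient topology. -/
instance {K : Type} [Field K] [Algebra ℂ K] (A : Fin 2 → Subalgebra ℂ K) : TopologicalSpace (Moduli A) :=
  (inferInstance : TopologicalSpace (IrrConnection A)).coinduced Moduli.mk

/-- Regular functions on an open subset of the moduli space: those that are regular as functions
of the connection. -/
def Moduli.IsRegularOn {K : Type} [Field K] [Algebra ℂ K] {A : Fin 2 → Subalgebra ℂ K} (O : Set (Moduli A)) (f : Moduli A → ℂ) :
    Prop :=
  GenusTwo.IsRegularOn IrrConnection.form (Moduli.mk ⁻¹' O) (fun D => f (Moduli.mk D))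

end GenusTwo

end

/-! The form dx/y has no zero or pole except a double zero at infinity. Hence the holomorphic forms
are p(x) dx/y with deg p ≤ 1, and the quadratic differentials are p(x) (dx/y)² with deg p ≤ 2
(`mem_holForm_iff`, `mem_holQuad_iff`). A trace-free connection becomes a pencil M = M₀ + x M₁ of
trace-free complex matrices. Bundle automorphisms are constant, so isomorphism is simultaneous
conjugation of M₀ and M₁, and det θ becomes the quadratic polynomial det M.

An invariant line subbundle is constant. Conceptually it inherits a holomorphic connection, hence
has degree 0, and a line subbundle of degree 0 in a trivial bundle is constant. The argument here is
elementary: the slope of the line solves a Riccati equation, and a degree count, in which deg F = 5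
for the quintic F, rules out nonconstant solutions (`exists_algebraMap_eq_of_deriv_eq`). So a
connection is reducible exactly when M₀ and M₁ have a common eigenvector, which happens exactly when
det M is a square (`hasEigenline_iff`).

If there is no common eigenvector, an eigenvector v of M₁ together with M₀ v is a basis in which M
has a normal form depending only on q = det M and a root u of u² = -q₂, with q₂ the coefficient of
x² (`exists_conj_normalMatrix`). This gives bijectivity.

The normal form is only a two-valued section of det. A polynomial on matrices restricts to it as
p(q) + u p'(q), and both signs of u give the same isomorphism class. Adding and subtracting the two
values eliminates u, so open sets and regular functions descend to U (`isOpenMap_moduliDet`,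
`isRegularOn_of_moduliDet`). -/

open scoped TensorProduct

noncomputable section

namespace GenusTwo

open Polynomial

section

variable {r s t : ℂ}

/-! ### The function field -/

/-- The inclusion of `ℂ(x)` in the function field. -/
def ratFuncHom (r s t : ℂ) : RatFunc ℂ →+* FunctionField r s t := AdjoinRoot.of (definingPoly r s t)

/-- The evaluation at `y` of polynomials with coefficients in `ℂ(x)`. -/
def polyHom (r s t : ℂ) : (RatFunc ℂ)[X] →+* FunctionField r s t :=
  AdjoinRoot.mk (definingPoly r s t)

/-- The evaluation of a polynomial at the coordinate function `x`. -/
def evX (r s t : ℂ) : ℂ[X] →ₐ[ℂ] FunctionField r s t := aeval (coordX r s t)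

theorem algebraMap_eq_ratFuncHom (z : ℂ) :
    algebraMap ℂ (FunctionField r s t) z = ratFuncHom r s t (algebraMap ℂ (RatFunc ℂ) z) := rfl

theorem coordX_eq_ratFuncHom : coordX r s t = ratFuncHom r s t RatFunc.X := rfl

theorem polyHom_C (a : RatFunc ℂ) : polyHom r s t (C a) = ratFuncHom r s t a := AdjoinRoot.mk_C _

theorem polyHom_X : polyHom r s t X = coordY r s t := AdjoinRoot.mk_X

theorem polyHom_surjective : Function.Surjective (polyHom r s t) := AdjoinRoot.mk_surjective

theorem polyHom_eq_zero {p : (RatFunc ℂ)[X]} : polyHom r s t p = 0 ↔ definingPoly r s t ∣ p :=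
  AdjoinRoot.mk_eq_zero

theorem evX_eq_ratFuncHom (p : ℂ[X]) :
    evX r s t p = ratFuncHom r s t (algebraMap ℂ[X] (RatFunc ℂ) p) := by
  induction p using Polynomial.induction_on' with
  | add p q hp hq => simp only [map_add, hp, hq]
  | monomial n a =>
    rw [← C_mul_X_pow_eq_monomial, map_mul, map_pow, map_mul, map_pow, map_mul, map_pow]
    simp only [evX, aeval_C, aeval_X, RatFunc.algebraMap_X, RatFunc.algebraMap_C,
      algebraMap_eq_ratFuncHom, coordX_eq_ratFuncHom]
    rfl

theorem definingPoly_monic : (definingPoly r s t).Monic := by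
  unfold definingPoly
  exact monic_X_pow_sub_C _ two_ne_zero

theorem definingPoly_natDegree : (definingPoly r s t).natDegree = 2 := by
  unfold definingPoly
  exact natDegree_X_pow_sub_C

theorem coordY_sq : coordY r s t ^ 2 = evX r s t (quintic r s t) := by
  have h : polyHom r s t (definingPoly r s t) = 0 := polyHom_eq_zero.2 dvd_rfl
  rw [definingPoly, map_sub, map_pow, polyHom_X, polyHom_C, sub_eq_zero] at h
  rw [evX_eq_ratFuncHom, h]

/-- The functions 1 and y are independent over ℂ(x) because the defining polynomial of y has degree
2. Identities in the function field can therefore be compared coefficientwise in ℂ[x]. -/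
theorem evX_add_mul_eq_zero {p q : ℂ[X]} (h : evX r s t p + evX r s t q * coordY r s t = 0) :
    p = 0 ∧ q = 0 := by
  have h1 : polyHom r s t
      (C (algebraMap ℂ[X] (RatFunc ℂ) q) * X + C (algebraMap ℂ[X] (RatFunc ℂ) p)) = 0 := by
    rw [map_add, map_mul, polyHom_C, polyHom_C, polyHom_X, ← evX_eq_ratFuncHom,
      ← evX_eq_ratFuncHom, add_comm]
    exact h
  have h2 := eq_zero_of_dvd_of_natDegree_lt (polyHom_eq_zero.1 h1) (by
    rw [definingPoly_natDegree]
    exact lt_of_le_of_lt natDegree_linear_le (by norm_num))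
  have e0 := congrArg (fun w => coeff w 0) h2
  have e1 := congrArg (fun w => coeff w 1) h2
  simp [coeff_C] at e0 e1
  exact ⟨e0, e1⟩

theorem evX_add_mul_inj {p q p' q' : ℂ[X]}
    (h : evX r s t p + evX r s t q * coordY r s t = evX r s t p' + evX r s t q' * coordY r s t) :
    p = p' ∧ q = q' := by
  have := evX_add_mul_eq_zero (r := r) (s := s) (t := t) (p := p - p') (q := q - q') (by
    rw [map_sub, map_sub]; linear_combination h)
  exact ⟨sub_eq_zero.1 this.1, sub_eq_zero.1 this.2⟩

theorem evX_injective : Function.Injective (evX r s t) := by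
  refine (injective_iff_map_eq_zero _).2 fun p hp => ?_
  exact (evX_add_mul_eq_zero (q := 0) (by simpa using hp)).1

theorem evX_ne_zero {p : ℂ[X]} (hp : p ≠ 0) : evX r s t p ≠ 0 :=
  (map_ne_zero_iff _ evX_injective).2 hp

theorem exists_evX_mul_eq (f : FunctionField r s t) :
    ∃ d p q : ℂ[X], d ≠ 0 ∧ evX r s t d * f = evX r s t p + evX r s t q * coordY r s t := by
  obtain ⟨g, rfl⟩ := polyHom_surjective f
  rw [← modByMonic_add_div g (definingPoly r s t), map_add, map_mul,
    polyHom_eq_zero.2 (dvd_refl (definingPoly r s t)), zero_mul, add_zero]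
  have hdeg : (g %ₘ definingPoly r s t).natDegree ≤ 1 := by
    have := natDegree_modByMonic_lt g (definingPoly_monic (r := r) (s := s) (t := t)) (by
      intro h
      have := definingPoly_natDegree (r := r) (s := s) (t := t)
      rw [h] at this
      simp at this)
    rw [definingPoly_natDegree] at this
    omega
  rw [eq_X_add_C_of_natDegree_le_one hdeg, map_add, map_mul, polyHom_C, polyHom_C, polyHom_X]
  obtain ⟨n, d, hd, e⟩ := IsFractionRing.div_surjective (A := ℂ[X])
    ((g %ₘ definingPoly r s t).coeff 0)
  obtain ⟨n', d', hd', e'⟩ := IsFractionRing.div_surjective (A := ℂ[X])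
    ((g %ₘ definingPoly r s t).coeff 1)
  have hd0 := nonZeroDivisors.ne_zero hd
  have hd0' := nonZeroDivisors.ne_zero hd'
  refine ⟨d * d', n * d', n' * d, mul_ne_zero hd0 hd0', ?_⟩
  have h0 := evX_ne_zero (r := r) (s := s) (t := t) hd0
  have h0' := evX_ne_zero (r := r) (s := s) (t := t) hd0'
  rw [← e, ← e', map_div₀, map_div₀, map_mul, map_mul, map_mul]
  simp only [← evX_eq_ratFuncHom]
  field_simp
  ring

theorem coordX_eq_evX : coordX r s t = evX r s t X := by simp [evX]

theorem algebraMap_eq_evX (z : ℂ) : algebraMap ℂ (FunctionField r s t) z = evX r s t (C z) := by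
  simp [evX]

theorem quintic_ne_zero : quintic r s t ≠ 0 := by
  intro h
  have := quintic_natDegree r s t
  rw [h] at this
  simp at this

theorem coordX_ne_zero : coordX r s t ≠ 0 := by
  rw [coordX_eq_evX]; exact evX_ne_zero X_ne_zero

theorem coordY_ne_zero : coordY r s t ≠ 0 := by
  intro h
  have := coordY_sq (r := r) (s := s) (t := t)
  rw [h, zero_pow two_ne_zero] at this
  exact evX_ne_zero quintic_ne_zero this.symm

theorem quintic_separable (h : ([0, 1, r, s, t] : List ℂ).Nodup) : (quintic r s t).Separable := by
  have h' : quintic r s t = (([0, 1, r, s, t] : List ℂ).map fun a => X - C a).prod := by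
    simp [quintic, mul_assoc]
  rw [h', ← List.prod_toFinset _ h]
  exact separable_prod_X_sub_C_iff'.2 (by simp)

/-! ### Rational differentials -/

instance : Algebra ℂ[X] (FunctionField r s t) := (evX r s t).toAlgebra

instance : Algebra (RatFunc ℂ) (FunctionField r s t) :=
  inferInstanceAs (Algebra (RatFunc ℂ) (AdjoinRoot (definingPoly r s t)))

instance : IsScalarTower ℂ ℂ[X] (FunctionField r s t) :=
  IsScalarTower.of_algebraMap_eq fun z => by
    rw [algebraMap_eq_evX]; rfl

instance : IsScalarTower ℂ[X] (RatFunc ℂ) (FunctionField r s t) :=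
  IsScalarTower.of_algebraMap_eq evX_eq_ratFuncHom

theorem finiteDimensional_functionField : FiniteDimensional (RatFunc ℂ) (FunctionField r s t) :=
  (AdjoinRoot.powerBasis (definingPoly_irreducible r s t).ne_zero).finite

/-- The extension is a localization followed by a finite separable extension. Formal étaleness makes
the rational forms one-dimensional with basis dx. -/
instance : Algebra.FormallyEtale ℂ[X] (FunctionField r s t) := by
  have := finiteDimensional_functionField (r := r) (s := s) (t := t)
  have h1 : Algebra.FormallyEtale ℂ[X] (RatFunc ℂ) :=
    Algebra.FormallyEtale.of_isLocalization (nonZeroDivisors ℂ[X])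
  have h2 : Algebra.FormallyEtale (RatFunc ℂ) (FunctionField r s t) :=
    Algebra.FormallyEtale.of_isSeparable _ _
  exact Algebra.FormallyEtale.comp ℂ[X] (RatFunc ℂ) (FunctionField r s t)

/-- The isomorphism of the space of rational `1`-forms with the function field that maps
`dx` to `1`. -/
def coefDX (r s t : ℂ) : RatForm (FunctionField r s t) ≃ₗ[FunctionField r s t] FunctionField r s t :=
  (KaehlerDifferential.tensorKaehlerEquivOfFormallyEtale ℂ ℂ[X] (FunctionField r s t)).symm ≪≫ₗ
    TensorProduct.AlgebraTensorModule.congr (LinearEquiv.refl _ _)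
      (KaehlerDifferential.polynomialEquiv ℂ) ≪≫ₗ
    TensorProduct.AlgebraTensorModule.rid ℂ[X] (FunctionField r s t) (FunctionField r s t)

theorem coefDX_D_evX (p : ℂ[X]) :
    coefDX r s t (KaehlerDifferential.D ℂ _ (evX r s t p)) = evX r s t (derivative p) := by
  have : evX r s t p = algebraMap ℂ[X] (FunctionField r s t) p := rfl
  rw [coefDX, LinearEquiv.trans_apply, LinearEquiv.trans_apply, this,
    KaehlerDifferential.tensorKaehlerEquivOfFormallyEtale_symm_D_algebraMap]
  simp [Algebra.smul_def]
  rfl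

/-- The isomorphism of the space of rational `1`-forms with the function field that maps
`dx / y` to `1`. -/
def coef (r s t : ℂ) : RatForm (FunctionField r s t) ≃ₗ[FunctionField r s t] FunctionField r s t :=
  coefDX r s t ≪≫ₗ LinearEquiv.smulOfNeZero _ _ (coordY r s t) coordY_ne_zero

theorem coef_apply (η : RatForm (FunctionField r s t)) :
    coef r s t η = coordY r s t * coefDX r s t η := rfl

/-- The derivation `f ↦ df / (dx / y)` of the function field. -/
def deriv (r s t : ℂ) : Derivation ℂ (FunctionField r s t) (FunctionField r s t) :=
  (coef r s t).toLinearMap.compDer (KaehlerDifferential.D ℂ _)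

theorem coef_D (f : FunctionField r s t) :
    coef r s t (KaehlerDifferential.D ℂ _ f) = deriv r s t f := rfl

theorem deriv_evX (p : ℂ[X]) : deriv r s t (evX r s t p) = coordY r s t * evX r s t (derivative p) := by
  rw [← coef_D, coef_apply, coefDX_D_evX]

theorem deriv_coordX : deriv r s t (coordX r s t) = coordY r s t := by
  rw [coordX_eq_evX, deriv_evX]; simp

theorem two_mul_deriv_coordY :
    2 * deriv r s t (coordY r s t) = evX r s t (derivative (quintic r s t)) := by
  have h := deriv_evX (r := r) (s := s) (t := t) (quintic r s t)
  rw [← coordY_sq, Derivation.leibniz_pow] at h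
  simp only [Nat.add_one_sub_one, pow_one, nsmul_eq_mul, smul_eq_mul, Nat.cast_ofNat] at h
  exact mul_left_cancel₀ coordY_ne_zero (by linear_combination h)

/-- The isomorphism of the space of rational quadratic differentials with the function field that
maps `(dx / y) ⊗ (dx / y)` to `1`. -/
def coefQuad (r s t : ℂ) :
    RatQuad (FunctionField r s t) ≃ₗ[FunctionField r s t] FunctionField r s t :=
  TensorProduct.congr (coef r s t) (coef r s t) ≪≫ₗ TensorProduct.lid _ _

theorem coefQuad_tmul (ω η : RatForm (FunctionField r s t)) :
    coefQuad r s t (ω ⊗ₜ η) = coef r s t ω * coef r s t η := by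
  simp [coefQuad]

end

section

variable {r s t : ℂ}

/-! ### The coordinate rings of the charts -/

theorem mem_adjoin_pair_iff {K : Type} [Field K] [Algebra ℂ K] {u v : K} {G : ℂ[X]}
    (hG : v ^ 2 = aeval u G) (f : K) :
    f ∈ Algebra.adjoin ℂ {u, v} ↔ ∃ p q : ℂ[X], f = aeval u p + aeval u q * v := by
  constructor
  · intro hf
    induction hf using Algebra.adjoin_induction with
    | mem z hz =>
      rcases hz with rfl | rfl
      · exact ⟨X, 0, by simp⟩
      · exact ⟨0, 1, by simp⟩
    | algebraMap z => exact ⟨C z, 0, by simp⟩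
    | add a b _ _ ha hb =>
      obtain ⟨p, q, rfl⟩ := ha
      obtain ⟨p', q', rfl⟩ := hb
      exact ⟨p + p', q + q', by simp only [map_add]; ring⟩
    | mul a b _ _ ha hb =>
      obtain ⟨p, q, rfl⟩ := ha
      obtain ⟨p', q', rfl⟩ := hb
      refine ⟨p * p' + q * q' * G, p * q' + q * p', ?_⟩
      simp only [map_add, map_mul, ← hG]
      ring
  · rintro ⟨p, q, rfl⟩
    have hu : u ∈ Algebra.adjoin ℂ {u, v} := Algebra.subset_adjoin (by simp)
    have hv : v ∈ Algebra.adjoin ℂ {u, v} := Algebra.subset_adjoin (by simp)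
    have key : ∀ p : ℂ[X], aeval u p ∈ Algebra.adjoin ℂ {u, v} := fun p =>
      Algebra.adjoin_mono (by simp) (aeval_mem_adjoin_singleton ℂ u)
    exact add_mem (key p) (mul_mem (key q) hv)

theorem mem_chart_zero_iff (f : FunctionField r s t) :
    f ∈ chart r s t 0 ↔ ∃ p q : ℂ[X], f = evX r s t p + evX r s t q * coordY r s t :=
  mem_adjoin_pair_iff coordY_sq f

/-- The quintic polynomial of the chart at infinity. -/
def quinticInfty (r s t : ℂ) : ℂ[X] := C (r * s * t) * quintic r⁻¹ s⁻¹ t⁻¹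

theorem nodup_ne_zero (h : ([0, 1, r, s, t] : List ℂ).Nodup) : r ≠ 0 ∧ s ≠ 0 ∧ t ≠ 0 := by
  simp only [List.nodup_cons, List.mem_cons, List.not_mem_nil, not_or] at h
  exact ⟨Ne.symm h.1.2.1, Ne.symm h.1.2.2.1, Ne.symm h.1.2.2.2.1⟩

theorem quinticInfty_separable (h : ([0, 1, r, s, t] : List ℂ).Nodup) :
    (quinticInfty r s t).Separable := by
  obtain ⟨hr, hs, ht⟩ := nodup_ne_zero h
  have h' : ([0, 1, r⁻¹, s⁻¹, t⁻¹] : List ℂ).Nodup := by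
    have := h.map (inv_injective (G := ℂ))
    simpa using this
  exact (quintic_separable h').unit_mul
    (isUnit_C.2 (isUnit_iff_ne_zero.2 (mul_ne_zero (mul_ne_zero hr hs) ht)))

/-- With u = 1/x, F(x)/x⁶ = u(1 - u)(1 - ru)(1 - su)(1 - tu). Pulling r, s, t out of the last three
factors gives the constant rst; the four signs cancel. -/
theorem coordY_infty_sq (h : ([0, 1, r, s, t] : List ℂ).Nodup) :
    (coordY r s t * (coordX r s t)⁻¹ ^ 3) ^ 2 = aeval (coordX r s t)⁻¹ (quinticInfty r s t) := by
  obtain ⟨hr, hs, ht⟩ := nodup_ne_zero h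
  have hx := coordX_ne_zero (r := r) (s := s) (t := t)
  have e : ∀ z : ℂ, z ≠ 0 → algebraMap ℂ (FunctionField r s t) z ≠ 0 := fun z hz =>
    (_root_.map_ne_zero _).2 hz
  have hr' := e r hr
  have hs' := e s hs
  have ht' := e t ht
  rw [mul_pow, coordY_sq]
  simp only [quinticInfty, quintic, evX, map_mul, map_sub, aeval_X, aeval_C, map_one, map_inv₀]
  field_simp
  ring

theorem mem_chart_one_iff (h : ([0, 1, r, s, t] : List ℂ).Nodup) (f : FunctionField r s t) :
    f ∈ chart r s t 1 ↔ ∃ p q : ℂ[X], f = aeval (coordX r s t)⁻¹ p +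
      aeval (coordX r s t)⁻¹ q * (coordY r s t * (coordX r s t)⁻¹ ^ 3) :=
  mem_adjoin_pair_iff (coordY_infty_sq h) f

theorem evX_mul_inv_pow {p : ℂ[X]} {N : ℕ} (hp : p.natDegree ≤ N) :
    evX r s t p * (coordX r s t)⁻¹ ^ N = aeval (coordX r s t)⁻¹ (p.reflect N) := by
  have hx := coordX_ne_zero (r := r) (s := s) (t := t)
  let := invertibleOfNonzero hx
  have := eval₂_reflect_mul_pow (algebraMap ℂ (FunctionField r s t)) (coordX r s t) N p hp
  rw [invOf_eq_inv] at this
  rw [evX, aeval_def, aeval_def, ← this, mul_assoc, ← mul_pow, mul_inv_cancel₀ hx, one_pow, mul_one]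

theorem aeval_inv_mul_pow {p : ℂ[X]} {N : ℕ} (hp : p.natDegree ≤ N) :
    aeval (coordX r s t)⁻¹ p * coordX r s t ^ N = evX r s t (p.reflect N) := by
  have hx := coordX_ne_zero (r := r) (s := s) (t := t)
  have h := evX_mul_inv_pow (r := r) (s := s) (t := t) (p := p.reflect N) (N := N)
    ((natDegree_reflect_le).trans (max_le le_rfl hp))
  rw [reflect_reflect] at h
  rw [← h, mul_assoc, ← mul_pow, inv_mul_cancel₀ hx, one_pow, mul_one]

theorem evX_mul_inv_pow_mem (h : ([0, 1, r, s, t] : List ℂ).Nodup) {p : ℂ[X]} {N : ℕ}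
    (hp : p.natDegree ≤ N) : evX r s t p * (coordX r s t)⁻¹ ^ N ∈ chart r s t 1 :=
  (mem_chart_one_iff h _).2 ⟨p.reflect N, 0, by rw [evX_mul_inv_pow hp]; simp⟩

/-- The functions regular on the affine chart with a pole of order at most `2 k ≤ 4` at infinity
are the polynomials in `x` of degree at most `k`. -/
theorem exists_evX_eq_of_mem (h : ([0, 1, r, s, t] : List ℂ).Nodup) {f : FunctionField r s t}
    {k : ℕ} (hk : k ≤ 2) (h0 : f ∈ chart r s t 0)
    (h1 : f * (coordX r s t)⁻¹ ^ k ∈ chart r s t 1) :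
    ∃ p : ℂ[X], p.natDegree ≤ k ∧ f = evX r s t p := by
  obtain ⟨p, q, rfl⟩ := (mem_chart_zero_iff _).1 h0
  obtain ⟨P, Q, e⟩ := (mem_chart_one_iff h _).1 h1
  have hx := coordX_ne_zero (r := r) (s := s) (t := t)
  obtain ⟨N, hP, hQ⟩ : ∃ N, P.natDegree ≤ N ∧ Q.natDegree ≤ N :=
    ⟨_, le_max_left _ _, le_max_right _ _⟩
  have eP := aeval_inv_mul_pow (r := r) (s := s) (t := t) hP
  have eQ := aeval_inv_mul_pow (r := r) (s := s) (t := t) hQ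
  have dP : (P.reflect N).natDegree ≤ N := natDegree_reflect_le.trans (max_le le_rfl hP)
  have dQ : (Q.reflect N).natDegree ≤ N := natDegree_reflect_le.trans (max_le le_rfl hQ)
  -- Multiplying by x^(N+3) clears all negative powers of x, so that the parts without y and with y
  -- can be compared as polynomials.
  have key : evX r s t (X ^ (N + 3) * p) + evX r s t (X ^ (N + 3) * q) * coordY r s t =
      evX r s t (X ^ (3 + k) * P.reflect N) + evX r s t (X ^ k * Q.reflect N) * coordY r s t := by
    simp only [map_mul, map_pow, ← coordX_eq_evX, ← eP, ← eQ]
    have e' : (evX r s t p + evX r s t q * coordY r s t) =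
      (aeval (coordX r s t)⁻¹ P +
        aeval (coordX r s t)⁻¹ Q * (coordY r s t * (coordX r s t)⁻¹ ^ 3)) * coordX r s t ^ k := by
      rw [← e, mul_assoc, ← mul_pow, inv_mul_cancel₀ hx, one_pow, mul_one]
    have e3 : (coordX r s t)⁻¹ ^ 3 * coordX r s t ^ 3 = 1 := by
      rw [← mul_pow, inv_mul_cancel₀ hx, one_pow]
    generalize aeval (coordX r s t)⁻¹ P = a at *
    generalize aeval (coordX r s t)⁻¹ Q = b at *
    rw [pow_add, pow_add]
    linear_combination coordX r s t ^ N * coordX r s t ^ 3 * e' +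
      b * coordY r s t * coordX r s t ^ k * coordX r s t ^ N * e3
  obtain ⟨k1, k2⟩ := evX_add_mul_inj key
  have d1 := congrArg natDegree k1
  have d2 := congrArg natDegree k2
  -- The y-part reads q = x^(k-3) Q(1/x). For k ≤ 2 the right side has only negative powers of x.
  have hq : q = 0 := by
    by_contra hq
    rw [natDegree_X_pow_mul _ hq] at d2
    have : (X ^ k * Q.reflect N).natDegree ≤ k + N :=
      natDegree_mul_le.trans (add_le_add (natDegree_X_pow_le k) dQ)
    omega
  refine ⟨p, ?_, by rw [hq]; simp⟩
  rcases eq_or_ne p 0 with rfl | hp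
  · simp
  rw [natDegree_X_pow_mul _ hp] at d1
  have : (X ^ (3 + k) * P.reflect N).natDegree ≤ 3 + k + N :=
    natDegree_mul_le.trans (add_le_add (natDegree_X_pow_le _) dP)
  omega

/-! ### Differentials over the charts -/

/-- On a smooth chart v² = G(u) the forms are freely generated by du/v, which is w dx/y. Every
differential is a multiple of it since 2 dv = G'(u) du/v. Conversely aG + bG' = 1 gives du/v = a v
du + 2b dv, so separability of G makes du/v regular. -/
theorem mem_chartForms_iff {A : Fin 2 → Subalgebra ℂ (FunctionField r s t)} {c : Fin 2}
    {u v w : FunctionField r s t} {G : ℂ[X]} (hA : A c = Algebra.adjoin ℂ {u, v})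
    (hG : v ^ 2 = aeval u G) (hsep : G.Separable) (hv0 : v ≠ 0) (hu : deriv r s t u = v * w)
    (η : RatForm (FunctionField r s t)) :
    η ∈ chartForms A c ↔ ∃ h ∈ A c, coef r s t η = h * w := by
  have huA : u ∈ A c := hA ▸ Algebra.subset_adjoin (by simp)
  have hvA : v ∈ A c := hA ▸ Algebra.subset_adjoin (by simp)
  have hpA : ∀ p : ℂ[X], aeval u p ∈ A c := fun p =>
    hA ▸ Algebra.adjoin_mono (by simp) (aeval_mem_adjoin_singleton ℂ u)
  have hdG : ∀ p : ℂ[X], deriv r s t (aeval u p) = aeval u (derivative p) * (v * w) := fun p => by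
    rw [Derivation.map_aeval, hu, smul_eq_mul]
  have hdv : 2 * deriv r s t v = aeval u (derivative G) * w := by
    have := hdG G
    rw [← hG, Derivation.leibniz_pow] at this
    simp only [Nat.add_one_sub_one, pow_one, nsmul_eq_mul, smul_eq_mul, Nat.cast_ofNat] at this
    exact mul_left_cancel₀ hv0 (by linear_combination this)
  constructor
  · rintro ⟨ζ, rfl⟩
    have hζ : ζ ∈ Submodule.span (A c) (Set.range (KaehlerDifferential.D ℂ (A c))) := by
      rw [KaehlerDifferential.span_range_derivation]; trivial
    induction hζ using Submodule.span_induction with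
    | mem z hz =>
      obtain ⟨a, rfl⟩ := hz
      rw [KaehlerDifferential.map_D, coef_D]
      obtain ⟨p, q, hpq⟩ := (mem_adjoin_pair_iff hG (a : FunctionField r s t)).1 (hA ▸ a.2)
      refine ⟨aeval u (derivative p) * v + aeval u (derivative q) * v * v +
        aeval u q * aeval u (C (1 / 2) * derivative G), ?_, ?_⟩
      · exact add_mem (add_mem (mul_mem (hpA _) hvA) (mul_mem (mul_mem (hpA _) hvA) hvA))
          (mul_mem (hpA _) (hpA _))
      · change deriv r s t (a : FunctionField r s t) = _
        rw [hpq, map_add, Derivation.leibniz, hdG, hdG, smul_eq_mul, smul_eq_mul, map_mul, aeval_C]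
        have h2 : algebraMap ℂ (FunctionField r s t) (1 / 2) * 2 = 1 := by
          rw [← map_ofNat (algebraMap ℂ (FunctionField r s t)) 2, ← map_mul]; simp
        linear_combination aeval u q * algebraMap ℂ (FunctionField r s t) (1 / 2) * hdv
          - aeval u q * deriv r s t v * h2
    | zero => exact ⟨0, zero_mem _, by simp⟩
    | add a b _ _ ha hb =>
      obtain ⟨h, hh, e⟩ := ha
      obtain ⟨h', hh', e'⟩ := hb
      exact ⟨h + h', add_mem hh hh', by rw [map_add, map_add, e, e', add_mul]⟩
    | smul a b _ hb =>
      obtain ⟨h, hh, e⟩ := hb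
      refine ⟨a * h, mul_mem a.2 hh, ?_⟩
      rw [map_smul, algebra_compatible_smul (FunctionField r s t) a, map_smul, e, smul_eq_mul,
        mul_assoc]
      rfl
  · rintro ⟨h, hh, e⟩
    obtain ⟨a, b, hab⟩ := hsep
    refine ⟨(⟨h * (aeval u a * v), mul_mem hh (mul_mem (hpA a) hvA)⟩ : A c) •
      KaehlerDifferential.D ℂ (A c) ⟨u, huA⟩ +
      (⟨h * (2 * aeval u b), mul_mem hh (mul_mem (ofNat_mem _ 2) (hpA b))⟩ : A c) •
      KaehlerDifferential.D ℂ (A c) ⟨v, hvA⟩, (coef r s t).injective ?_⟩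
    rw [map_add, map_smul, map_smul, KaehlerDifferential.map_D, KaehlerDifferential.map_D, map_add,
      algebra_compatible_smul (FunctionField r s t) (_ : A c),
      algebra_compatible_smul (FunctionField r s t) (_ : A c), map_smul, map_smul, coef_D, coef_D, e]
    change h * (aeval u a * v) * deriv r s t u + h * (2 * aeval u b) * deriv r s t v = h * w
    have hab' := congrArg (aeval u) hab
    simp only [map_add, map_mul, map_one, ← hG] at hab'
    linear_combination h * w * hab' + h * aeval u b * hdv + h * aeval u a * v * hu

theorem mem_chartForms_zero_iff (h : ([0, 1, r, s, t] : List ℂ).Nodup)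
    (η : RatForm (FunctionField r s t)) :
    η ∈ chartForms (chart r s t) 0 ↔ coef r s t η ∈ chart r s t 0 := by
  rw [mem_chartForms_iff (u := coordX r s t) (v := coordY r s t) (w := 1) rfl coordY_sq
    (quintic_separable h) coordY_ne_zero (by rw [deriv_coordX, mul_one])]
  simp

theorem mem_chartForms_one_iff (h : ([0, 1, r, s, t] : List ℂ).Nodup)
    (η : RatForm (FunctionField r s t)) :
    η ∈ chartForms (chart r s t) 1 ↔ coef r s t η * (coordX r s t)⁻¹ ∈ chart r s t 1 := by
  have hx := coordX_ne_zero (r := r) (s := s) (t := t)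
  rw [mem_chartForms_iff (u := (coordX r s t)⁻¹) (v := coordY r s t * (coordX r s t)⁻¹ ^ 3)
    -- For u = 1/x and v = y/x³, du = -dx/x² = v · (-x) dx/y.
    (w := -coordX r s t) rfl (coordY_infty_sq h)
    (quinticInfty_separable h) (mul_ne_zero coordY_ne_zero (pow_ne_zero _ (inv_ne_zero hx)))
    (by rw [Derivation.leibniz_inv, deriv_coordX, smul_eq_mul]; field_simp)]
  constructor
  · rintro ⟨k, hk, e⟩
    rw [e]
    convert neg_mem hk using 1
    field_simp
  · intro hk
    exact ⟨_, neg_mem hk, by field_simp⟩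

theorem mem_chartQuads_iff {A : Fin 2 → Subalgebra ℂ (FunctionField r s t)} {c : Fin 2}
    {w : FunctionField r s t} (hw : w ≠ 0)
    (hA : ∀ η, η ∈ chartForms A c ↔ coef r s t η * w ∈ A c)
    (q : RatQuad (FunctionField r s t)) :
    q ∈ chartQuads A c ↔ coefQuad r s t q * w ^ 2 ∈ A c := by
  constructor
  · intro hq
    induction hq using Submodule.span_induction with
    | mem z hz =>
      obtain ⟨ω, hω, η, hη, rfl⟩ := hz
      rw [coefQuad_tmul]
      convert mul_mem ((hA _).1 hω) ((hA _).1 hη) using 1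
      ring
    | zero => simp
    | add a b _ _ ha hb => rw [map_add, add_mul]; exact add_mem ha hb
    | smul z b _ hb =>
      have : coefQuad r s t (z • b) = z • coefQuad r s t b := by
        rw [algebra_compatible_smul (FunctionField r s t) z, map_smul, ← algebra_compatible_smul]
      rw [this, smul_mul_assoc]
      exact Subalgebra.smul_mem _ hb z
  · intro hq
    -- The forms over the chart are generated by w⁻¹ dx/y, so a regular quadratic differential is a
    -- single tensor: put the whole coefficient in the first factor and this generator in the
    -- second.
    refine Submodule.subset_span ⟨(coef r s t).symm (coefQuad r s t q * w), ?_,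
      (coef r s t).symm w⁻¹, ?_, (coefQuad r s t).injective ?_⟩
    · rw [hA, LinearEquiv.apply_symm_apply, mul_assoc, ← sq]
      exact hq
    · rw [hA, LinearEquiv.apply_symm_apply, inv_mul_cancel₀ hw]
      exact one_mem _
    · rw [coefQuad_tmul, LinearEquiv.apply_symm_apply, LinearEquiv.apply_symm_apply]
      field_simp

/-! ### Global differentials -/

theorem mem_holForm_iff (h : ([0, 1, r, s, t] : List ℂ).Nodup)
    (η : RatForm (FunctionField r s t)) :
    η ∈ HolForm (chart r s t) ↔ ∃ p : ℂ[X], p.natDegree ≤ 1 ∧ coef r s t η = evX r s t p := by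
  rw [HolForm, Submodule.mem_iInf, Fin.forall_fin_two, mem_chartForms_zero_iff h,
    mem_chartForms_one_iff h]
  constructor
  · rintro ⟨h0, h1⟩
    exact exists_evX_eq_of_mem h one_le_two h0 (by rwa [pow_one])
  · rintro ⟨p, hp, e⟩
    rw [e]
    exact ⟨(mem_chart_zero_iff _).2 ⟨p, 0, by simp⟩, by simpa using evX_mul_inv_pow_mem h hp⟩

theorem mem_holQuad_iff (h : ([0, 1, r, s, t] : List ℂ).Nodup)
    (q : RatQuad (FunctionField r s t)) :
    q ∈ HolQuad (chart r s t) ↔ ∃ p : ℂ[X], p.natDegree ≤ 2 ∧ coefQuad r s t q = evX r s t p := by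
  have hx := coordX_ne_zero (r := r) (s := s) (t := t)
  rw [HolQuad, Submodule.mem_iInf, Fin.forall_fin_two,
    mem_chartQuads_iff one_ne_zero (by simpa using mem_chartForms_zero_iff h),
    mem_chartQuads_iff (inv_ne_zero hx) (mem_chartForms_one_iff h), one_pow, mul_one]
  constructor
  · rintro ⟨h0, h1⟩
    exact exists_evX_eq_of_mem h le_rfl h0 h1
  · rintro ⟨p, hp, e⟩
    rw [e]
    exact ⟨(mem_chart_zero_iff _).2 ⟨p, 0, by simp⟩, evX_mul_inv_pow_mem h hp⟩

theorem exists_algebraMap_eq_of_mem (h : ([0, 1, r, s, t] : List ℂ).Nodup) {f : FunctionField r s t}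
    (hf : ∀ c, f ∈ chart r s t c) : ∃ z : ℂ, f = algebraMap ℂ _ z := by
  obtain ⟨p, hp, rfl⟩ := exists_evX_eq_of_mem h (Nat.zero_le 2) (hf 0) (by simpa using hf 1)
  rw [eq_C_of_natDegree_le_zero hp]
  exact ⟨_, (algebraMap_eq_evX _).symm⟩

end

section

variable {r s t : ℂ}

/-! ### The Riccati equation -/

instance : CharZero (FunctionField r s t) :=
  charZero_of_injective_algebraMap (algebraMap ℂ (FunctionField r s t)).injective

/-- Cancelling the gcd of g and w leaves coprime a, b with a² ∣ F b². Hence a² ∣ F, and a is a unit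
because F is squarefree. -/
theorem dvd_of_mul_self_dvd_mul_sq {F g w : ℂ[X]} (hF : Squarefree F) (hg : g ≠ 0)
    (h : g * g ∣ F * w ^ 2) : g ∣ w := by
  obtain ⟨a, b, c, hab, rfl, rfl⟩ := UniqueFactorizationMonoid.exists_reduced_factors g hg w
  have hc : c ≠ 0 := left_ne_zero_of_mul hg
  have h1 : a * a ∣ F * b ^ 2 := by
    refine (mul_dvd_mul_iff_left (mul_ne_zero hc hc)).1 ?_
    convert h using 1 <;> ring
  have h2 : IsCoprime (a * a) (b ^ 2) := by
    have : IsCoprime a b := isRelPrime_iff_isCoprime.1 hab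
    exact (this.mul_left this).pow_right
  exact mul_dvd_mul_left c ((hF a (h2.dvd_of_dvd_mul_right h1)).dvd)

/-- Let m be the largest degree of the V i, attained at j. The discriminant gives 2 deg S + 5 ≤ 2m
if S ≠ 0, so deg S ≤ m - 3 and deg (E j * S) ≤ m - 2. Then V j * T, of degree at least m if T ≠ 0,
cannot equal V j' - E j * S, so T = 0. Now V j' has degree m - 1 but equals E j * S, so S = 0. -/
theorem eq_zero_of_derivative_eq {F S T : ℂ[X]} {V E : Fin 3 → ℂ[X]} (hF : F.natDegree = 5)
    (hV : ∃ i, V i ≠ 0) (hE : ∀ i, (E i).natDegree ≤ 1)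
    (hdisc : V 1 ^ 2 - 4 * V 0 * V 2 = F * S ^ 2)
    (hder : ∀ i, derivative (V i) = V i * T + E i * S) :
    S = 0 ∧ ∀ i, derivative (V i) = 0 := by
  have hF0 : F ≠ 0 := by rintro rfl; simp at hF
  obtain ⟨j, hj⟩ := Finite.exists_max fun i => (V i).degree
  have hj0 : V j ≠ 0 := by
    obtain ⟨i, hi⟩ := hV
    intro h
    have := hj i
    rw [h, degree_zero, le_bot_iff, degree_eq_bot] at this
    exact hi this
  have hle : ∀ i, (V i).natDegree ≤ (V j).natDegree := fun i => natDegree_le_natDegree (hj i)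
  have hS : S ≠ 0 → 2 * S.natDegree + 5 ≤ 2 * (V j).natDegree := by
    intro hS
    have e := congrArg natDegree hdisc
    rw [natDegree_mul hF0 (pow_ne_zero _ hS), natDegree_pow, hF] at e
    have l1 : (V 1 ^ 2).natDegree ≤ 2 * (V j).natDegree := by
      rw [natDegree_pow]; exact Nat.mul_le_mul_left 2 (hle 1)
    have l2 : (4 * V 0 * V 2).natDegree ≤ 2 * (V j).natDegree := by
      have : (4 * V 0 * V 2) = C 4 * (V 0 * V 2) := by
        rw [mul_assoc]; rfl
      rw [this]
      refine (natDegree_C_mul_le _ _).trans (natDegree_mul_le.trans ?_)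
      have := hle 0
      have := hle 2
      omega
    have := natDegree_sub_le_of_le l1 l2
    rw [max_self] at this
    omega
  have hES : (E j * S).natDegree ≤ 1 + S.natDegree :=
    natDegree_mul_le.trans (Nat.add_le_add_right (hE j) _)
  have hT : T = 0 := by
    by_contra hT
    have e : V j * T = derivative (V j) - E j * S := by rw [hder]; ring
    have d := congrArg natDegree e
    rw [natDegree_mul hj0 hT] at d
    by_cases hS0 : S = 0
    · rw [hS0, mul_zero, sub_zero] at e
      -- `degree` rather than `natDegree`: the strict drop must also hold for a constant V j.
      have hlt := degree_derivative_lt hj0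
      rw [← e, degree_mul] at hlt
      exact absurd hlt (not_lt.2 (le_add_of_nonneg_right (zero_le_degree_iff.2 hT)))
    · have h1 := hS hS0
      have h2 := natDegree_sub_le_of_le (natDegree_derivative_le (V j)) hES
      have h3 : max ((V j).natDegree - 1) (1 + S.natDegree) < (V j).natDegree :=
        max_lt (by omega) (by omega)
      omega
  have hS0 : S = 0 := by
    by_contra hS0
    have h1 := hS hS0
    have e := hder j
    rw [hT, mul_zero, zero_add] at e
    have d := congrArg natDegree e
    rw [natDegree_derivative] at d
    omega
  exact ⟨hS0, fun i => by rw [hder, hT, hS0, mul_zero, mul_zero, add_zero]⟩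

/-- A rational solution `f` of a Riccati equation `df = -γ + 2 α f + β f²` with holomorphic
`α`, `β`, `γ` is constant. -/
theorem exists_algebraMap_eq_of_deriv_eq (h : ([0, 1, r, s, t] : List ℂ).Nodup) {a b c : ℂ[X]}
    (ha : a.natDegree ≤ 1) (hb : b.natDegree ≤ 1) (hc : c.natDegree ≤ 1)
    {f : FunctionField r s t}
    (hf : deriv r s t f = -evX r s t c + 2 * evX r s t a * f + evX r s t b * f ^ 2) :
    ∃ z : ℂ, f = algebraMap ℂ _ z := by
  set F := quintic r s t with hFdef
  obtain ⟨d, p, q, hd0, hd⟩ := exists_evX_mul_eq f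
  -- Since d f = p + q y, f is a root of d² Z² - 2dp Z + (p² - q² F). Dividing by the gcd g of the
  -- coefficients gives the coprime triple P, Q, R.
  obtain ⟨g, hg⟩ := (IsPrincipalIdealRing.principal
    (Ideal.span {d ^ 2, -2 * d * p, p ^ 2 - q ^ 2 * F})).principal
  change Ideal.span _ = Ideal.span {g} at hg
  have hmem : ∀ z ∈ ({d ^ 2, -2 * d * p, p ^ 2 - q ^ 2 * F} : Set ℂ[X]), g ∣ z := fun z hz => by
    rw [← Ideal.mem_span_singleton, ← hg]
    exact Ideal.subset_span hz
  obtain ⟨P, hP⟩ := hmem (d ^ 2) (by simp)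
  obtain ⟨Q, hQ⟩ := hmem (-2 * d * p) (by simp)
  obtain ⟨R, hR⟩ := hmem (p ^ 2 - q ^ 2 * F) (by simp)
  have hg0 : g ≠ 0 := by
    rintro rfl
    rw [zero_mul] at hP
    exact pow_ne_zero 2 hd0 hP
  have hP0 : P ≠ 0 := by
    rintro rfl
    rw [mul_zero] at hP
    exact pow_ne_zero 2 hd0 hP
  obtain ⟨u, v, w, hbez⟩ : ∃ u v w, u * P + v * Q + w * R = 1 := by
    have := Ideal.mem_span_singleton_self g
    rw [← hg, Ideal.mem_span_insert] at this
    obtain ⟨u, z, hz, e⟩ := this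
    rw [Ideal.mem_span_pair] at hz
    obtain ⟨v, w, rfl⟩ := hz
    refine ⟨u, v, w, mul_left_cancel₀ hg0 ?_⟩
    linear_combination -e - u * hP - v * hQ - w * hR
  -- The discriminant of the undivided quadratic is F (2dq)² = g² (Q² - 4PR), and F is squarefree.
  have hdvd : g ∣ 2 * d * q := by
    refine dvd_of_mul_self_dvd_mul_sq (quintic_separable h).squarefree hg0
      ⟨Q ^ 2 - 4 * P * R, ?_⟩
    rw [← hFdef]
    linear_combination (-2 * d * p + g * Q) * hQ - 4 * (p ^ 2 - q ^ 2 * F) * hP - 4 * g * P * hR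
  obtain ⟨S, hS⟩ := hdvd
  have hdisc : Q ^ 2 - 4 * P * R = F * S ^ 2 := by
    refine mul_left_cancel₀ (mul_ne_zero hg0 hg0) ?_
    linear_combination -(-2 * d * p + g * Q) * hQ + 4 * (p ^ 2 - q ^ 2 * F) * hP + 4 * g * P * hR
      + F * (2 * d * q + g * S) * hS
  have hF2 := coordY_sq (r := r) (s := s) (t := t)
  have hdy := two_mul_deriv_coordY (r := r) (s := s) (t := t)
  rw [← hFdef] at hF2 hdy
  have hlin : 2 * evX r s t P * f = -evX r s t Q + evX r s t S * coordY r s t := by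
    refine mul_left_cancel₀ (evX_ne_zero (r := r) (s := s) (t := t) hg0) ?_
    have e1 := congrArg (evX r s t) hP
    have e2 := congrArg (evX r s t) hQ
    have e3 := congrArg (evX r s t) hS
    simp only [map_mul, map_pow, map_neg, map_ofNat] at e1 e2 e3
    linear_combination -2 * f * e1 - e2 + coordY r s t * e3 + 2 * evX r s t d * hd
  -- Differentiating P f² + Q f + R = 0, with 2P f + Q = S y and the Riccati equation, makes f a
  -- root of (P' + bS) Z² + (Q' + 2aS) Z + (R' - cS) too. This explains why `E1` and `E2` below
  -- should hold: the two quadratics are proportional. They are derived from the two components of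
  -- `hN` and the derivative of the discriminant identity.
  have hderiv := congrArg (deriv r s t) hlin
  have h2 : deriv r s t 2 = 0 := Derivation.map_natCast _ 2
  simp only [map_add, map_neg, Derivation.leibniz, smul_eq_mul, deriv_evX, hf, h2] at hderiv
  have hN : evX r s t (2 * derivative P * S * F - 4 * c * P ^ 2 - 4 * a * P * Q +
        b * (Q ^ 2 + S ^ 2 * F) - 2 * P * derivative S * F - P * S * derivative F) +
      evX r s t (-2 * derivative P * Q + 4 * a * P * S - 2 * b * Q * S + 2 * P * derivative Q) *
        coordY r s t = 0 := by
    simp only [map_add, map_sub, map_mul, map_pow, map_neg, map_ofNat, ← hF2, ← hdy]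
    generalize evX r s t P = P' at *
    generalize evX r s t Q = Q' at *
    generalize evX r s t S = S' at *
    generalize evX r s t a = a' at *
    generalize evX r s t b = b' at *
    generalize evX r s t c = c' at *
    generalize coordY r s t = y at *
    linear_combination 2 * P' * hderiv - (2 * evX r s t (derivative P) * y + 4 * a' * P' +
      b' * (2 * P' * f + (-Q' + S' * y))) * hlin
  obtain ⟨h0, h1⟩ := evX_add_mul_eq_zero hN
  have hdisc' := congrArg derivative hdisc
  simp only [derivative_sub, derivative_mul, derivative_pow, derivative_ofNat, Nat.cast_ofNat,
    map_ofNat, Nat.add_one_sub_one, pow_one] at hdisc'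
  have E1 : Q * (derivative P + b * S) = P * (derivative Q + 2 * a * S) := by
    refine mul_left_cancel₀ (two_ne_zero (α := ℂ[X])) ?_
    linear_combination -h1
  have E2 : R * (derivative P + b * S) = P * (derivative R - c * S) := by
    refine mul_left_cancel₀ (mul_ne_zero (by norm_num : (4 : ℂ[X]) ≠ 0) hP0) ?_
    linear_combination -S * h0 - Q * h1 - (2 * derivative P + b * S) * hdisc + P * hdisc'
  -- T is the factor of proportionality; the Bézout relation for P, Q, R shows that it is a
  -- polynomial.
  set T := u * (derivative P + b * S) + v * (derivative Q + 2 * a * S) +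
    w * (derivative R - c * S) with hT
  have T0 : derivative P + b * S = P * T := by
    rw [hT]
    linear_combination -(derivative P + b * S) * hbez + v * E1 + w * E2
  have T1 : derivative Q + 2 * a * S = Q * T :=
    mul_left_cancel₀ hP0 (by linear_combination -E1 + Q * T0)
  have T2 : derivative R - c * S = R * T :=
    mul_left_cancel₀ hP0 (by linear_combination -E2 + R * T0)
  obtain ⟨hS0, hV⟩ := eq_zero_of_derivative_eq (F := F) (S := S) (T := T) (V := ![P, Q, R])
    (E := ![-b, -(2 * a), c]) (quintic_natDegree r s t) ⟨0, hP0⟩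
    (by
      have h2a : (2 * a).natDegree ≤ 1 := (natDegree_C_mul_le 2 a).trans ha
      intro i
      fin_cases i
      · simpa using hb
      · simpa using h2a
      · exact hc) hdisc
    (by
      intro i
      fin_cases i
      · change derivative P = P * T + -b * S
        linear_combination T0
      · change derivative Q = Q * T + -(2 * a) * S
        linear_combination T1
      · change derivative R = R * T + c * S
        linear_combination T2)
  have hPC := eq_C_of_natDegree_eq_zero (derivative_eq_zero.1 (hV 0))
  have hQC := eq_C_of_natDegree_eq_zero (derivative_eq_zero.1 (hV 1))
  simp only [Matrix.cons_val_zero, Matrix.cons_val_one] at hPC hQC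
  have hp0 : P.coeff 0 ≠ 0 := fun h => hP0 (by rw [hPC, h, C_0])
  refine ⟨-Q.coeff 0 / (2 * P.coeff 0), ?_⟩
  rw [hS0, hPC, hQC, ← algebraMap_eq_evX, ← algebraMap_eq_evX] at hlin
  have hp1 : algebraMap ℂ (FunctionField r s t) (P.coeff 0) ≠ 0 := (_root_.map_ne_zero _).2 hp0
  rw [map_div₀, map_mul, map_neg, map_ofNat, eq_div_iff (mul_ne_zero two_ne_zero hp1)]
  rw [map_zero, zero_mul, add_zero] at hlin
  linear_combination hlin

end

section

/-! ### Connections and matrices of forms -/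

section General

variable {K : Type} [Field K] [Algebra ℂ K] {A : Fin 2 → Subalgebra ℂ K}

theorem smul_mem_chartForms {c : Fin 2} {g : K} (hg : g ∈ A c) {ω : RatForm K}
    (hω : ω ∈ chartForms A c) : g • ω ∈ chartForms A c :=
  (LinearMap.range (KaehlerDifferential.map ℂ ℂ (A c) K)).smul_mem (⟨g, hg⟩ : A c) hω

theorem D_mem_chartForms {c : Fin 2} {g : K} (hg : g ∈ A c) :
    KaehlerDifferential.D ℂ K g ∈ chartForms A c :=
  ⟨KaehlerDifferential.D ℂ (A c) ⟨g, hg⟩, KaehlerDifferential.map_D _ _ _ _ _⟩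

theorem mem_chartForms_of_holForm (ω : HolForm A) (c : Fin 2) : (ω : RatForm K) ∈ chartForms A c :=
  (Submodule.mem_iInf _).1 ω.2 c

theorem Connection.toMap_apply (D : Connection A) (v : Fin 2 → K) (i : Fin 2) :
    D.toMap v i = KaehlerDifferential.D ℂ K (v i) +
      (v 0 • (D.form i 0 : RatForm K) + v 1 • (D.form i 1 : RatForm K)) := by
  have hv : v = v 0 • Pi.single 0 1 + v 1 • Pi.single 1 1 := by
    funext j
    fin_cases j <;> simp
  conv_lhs => rw [hv, map_add, D.leibniz, D.leibniz]
  change (v 0 • (D.form i 0 : RatForm K) +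
    (Pi.single 0 1 : Fin 2 → K) i • KaehlerDifferential.D ℂ K (v 0)) +
    (v 1 • (D.form i 1 : RatForm K) +
    (Pi.single 1 1 : Fin 2 → K) i • KaehlerDifferential.D ℂ K (v 1)) = _
  fin_cases i <;> simp <;> abel

/-- The connection `d + θ`. -/
def Connection.ofForm (θ : Matrix (Fin 2) (Fin 2) (HolForm A)) : Connection A where
  toMap :=
    { toFun := fun v i => KaehlerDifferential.D ℂ K (v i) +
        (v 0 • (θ i 0 : RatForm K) + v 1 • (θ i 1 : RatForm K))
      map_add' := fun v w => by
        funext i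
        simp only [Pi.add_apply, map_add, add_smul]
        abel
      map_smul' := fun z v => by
        funext i
        simp only [Pi.smul_apply, Derivation.map_smul, smul_add, RingHom.id_apply, smul_assoc] }
  leibniz := fun g v => by
    funext i
    change KaehlerDifferential.D ℂ K (g * v i) + ((g * v 0) • _ + (g * v 1) • _) =
      g • (_ + (_ + _)) + _
    rw [Derivation.leibniz]
    simp only [smul_add, mul_smul]
    abel
  regular := fun c v hv i => add_mem (D_mem_chartForms (hv i))
    (add_mem (smul_mem_chartForms (hv 0) (mem_chartForms_of_holForm (θ i 0) c))
      (smul_mem_chartForms (hv 1) (mem_chartForms_of_holForm (θ i 1) c)))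

theorem Connection.form_ofForm (θ : Matrix (Fin 2) (Fin 2) (HolForm A)) :
    (Connection.ofForm θ).form = θ := by
  ext i j
  change KaehlerDifferential.D ℂ K ((Pi.single j 1 : Fin 2 → K) i) +
    ((Pi.single j 1 : Fin 2 → K) 0 • (θ i 0 : RatForm K) +
      (Pi.single j 1 : Fin 2 → K) 1 • (θ i 1 : RatForm K)) = θ i j
  fin_cases i <;> fin_cases j <;> simp

theorem Connection.traceFree_iff (D : Connection A) : D.TraceFree ↔ D.form 1 1 = -D.form 0 0 := by
  rw [Connection.TraceFree, Matrix.trace_fin_two, add_comm, eq_neg_iff_add_eq_zero]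

/-- A constant eigenline of `θ` is an invariant line subbundle. -/
theorem Connection.not_irreducible_of_eigenline (D : Connection A) {v : Fin 2 → ℂ} (hv : v ≠ 0)
    {ω : HolForm A} (h : ∀ i, v 0 • D.form i 0 + v 1 • D.form i 1 = v i • ω) :
    ¬ D.Irreducible := by
  intro hD
  set w : Fin 2 → K := fun i => algebraMap ℂ K (v i) with hw
  obtain ⟨k, hk⟩ := Function.ne_iff.1 hv
  have hwk : w k ≠ 0 := (_root_.map_ne_zero _).2 hk
  have hw0 : w ≠ 0 := Function.ne_iff.2 ⟨k, hwk⟩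
  have hws : ∀ c, IsSection A c w := fun c i => algebraMap_mem _ _
  refine hD ⟨Submodule.span K {w}, finrank_span_singleton hw0, fun c z hz hzs => ?_⟩
  obtain ⟨g, rfl⟩ := Submodule.mem_span_singleton.1 hz
  -- The coordinate w k is a nonzero constant, so g is regular wherever g • w is.
  have hg : g ∈ A c := by
    have := mul_mem (hzs k) (algebraMap_mem (A c) (v k)⁻¹)
    rw [Pi.smul_apply, smul_eq_mul, map_inv₀, mul_assoc, mul_inv_cancel₀ hwk, mul_one] at this
    exact this
  refine Submodule.subset_span ⟨w, Submodule.mem_span_singleton_self w, hws c,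
    KaehlerDifferential.D ℂ K g + g • (ω : RatForm K),
    add_mem (D_mem_chartForms hg) (smul_mem_chartForms hg (mem_chartForms_of_holForm ω c)), ?_⟩
  funext i
  have hi := congrArg (Subtype.val : HolForm A → RatForm K) (h i)
  simp only [Submodule.coe_add, Submodule.coe_smul] at hi
  rw [D.toMap_apply]
  simp only [Pi.smul_apply, smul_eq_mul, mul_smul, smul_add, hw, Derivation.leibniz,
    Derivation.map_algebraMap, smul_zero, zero_add, algebraMap_smul]
  rw [← smul_add, hi, smul_comm g, add_comm]

end General

variable {r s t : ℂ}

/-! ### Holomorphic differentials as polynomials -/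

/-- The polynomial `p` of degree at most `1` for which `ω = p(x) dx / y`. -/
def formPoly (h : ([0, 1, r, s, t] : List ℂ).Nodup) : HolForm (chart r s t) →ₗ[ℂ] ℂ[X] where
  toFun ω := ((mem_holForm_iff h _).1 ω.2).choose
  map_add' ω η := by
    refine evX_injective (r := r) (s := s) (t := t) ?_
    rw [map_add, ← ((mem_holForm_iff h _).1 (ω + η).2).choose_spec.2,
      ← ((mem_holForm_iff h _).1 ω.2).choose_spec.2, ← ((mem_holForm_iff h _).1 η.2).choose_spec.2,
      ← map_add]
    rfl
  map_smul' z ω := by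
    refine evX_injective (r := r) (s := s) (t := t) ?_
    rw [map_smul, ← ((mem_holForm_iff h _).1 (z • ω).2).choose_spec.2, RingHom.id_apply,
      ← ((mem_holForm_iff h _).1 ω.2).choose_spec.2, Submodule.coe_smul,
      algebra_compatible_smul (FunctionField r s t) z, map_smul, ← algebra_compatible_smul]

variable (h : ([0, 1, r, s, t] : List ℂ).Nodup)

theorem natDegree_formPoly_le (ω : HolForm (chart r s t)) : (formPoly h ω).natDegree ≤ 1 :=
  ((mem_holForm_iff h _).1 ω.2).choose_spec.1

theorem coef_eq_evX_formPoly (ω : HolForm (chart r s t)) :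
    coef r s t ω = evX r s t (formPoly h ω) :=
  ((mem_holForm_iff h _).1 ω.2).choose_spec.2

theorem formPoly_injective : Function.Injective (formPoly h) := fun ω η e => by
  have := coef_eq_evX_formPoly h ω
  rw [e, ← coef_eq_evX_formPoly] at this
  exact Subtype.ext ((coef r s t).injective this)

theorem exists_formPoly_eq {p : ℂ[X]} (hp : p.natDegree ≤ 1) : ∃ ω, formPoly h ω = p := by
  have e := (coef r s t).apply_symm_apply (evX r s t p)
  exact ⟨⟨(coef r s t).symm (evX r s t p), (mem_holForm_iff h _).2 ⟨p, hp, e⟩⟩,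
    evX_injective (by rw [← coef_eq_evX_formPoly, e])⟩

/-- The polynomial `p` of degree at most `2` for which `q = p(x) (dx / y) ⊗ (dx / y)`. -/
def quadPoly : HolQuad (chart r s t) →ₗ[ℂ] ℂ[X] where
  toFun ω := ((mem_holQuad_iff h _).1 ω.2).choose
  map_add' ω η := by
    refine evX_injective (r := r) (s := s) (t := t) ?_
    rw [map_add, ← ((mem_holQuad_iff h _).1 (ω + η).2).choose_spec.2,
      ← ((mem_holQuad_iff h _).1 ω.2).choose_spec.2, ← ((mem_holQuad_iff h _).1 η.2).choose_spec.2,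
      ← map_add]
    rfl
  map_smul' z ω := by
    refine evX_injective (r := r) (s := s) (t := t) ?_
    rw [map_smul, ← ((mem_holQuad_iff h _).1 (z • ω).2).choose_spec.2, RingHom.id_apply,
      ← ((mem_holQuad_iff h _).1 ω.2).choose_spec.2, Submodule.coe_smul,
      algebra_compatible_smul (FunctionField r s t) z, map_smul, ← algebra_compatible_smul]

theorem natDegree_quadPoly_le (q : HolQuad (chart r s t)) : (quadPoly h q).natDegree ≤ 2 :=
  ((mem_holQuad_iff h _).1 q.2).choose_spec.1

theorem coefQuad_eq_evX_quadPoly (q : HolQuad (chart r s t)) :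
    coefQuad r s t q = evX r s t (quadPoly h q) :=
  ((mem_holQuad_iff h _).1 q.2).choose_spec.2

theorem quadPoly_injective : Function.Injective (quadPoly h) := fun ω η e => by
  have := coefQuad_eq_evX_quadPoly h ω
  rw [e, ← coefQuad_eq_evX_quadPoly] at this
  exact Subtype.ext ((coefQuad r s t).injective this)

theorem quadPoly_tmul (ω η : HolForm (chart r s t)) :
    quadPoly h (HolForm.tmul ω η) = formPoly h ω * formPoly h η := by
  refine evX_injective (r := r) (s := s) (t := t) ?_
  rw [← coefQuad_eq_evX_quadPoly, map_mul, ← coef_eq_evX_formPoly, ← coef_eq_evX_formPoly]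
  exact coefQuad_tmul _ _

/-- The matrix of polynomials `M` with `θ = M(x) dx / y`. -/
def formMatrix (D : Connection (chart r s t)) : Matrix (Fin 2) (Fin 2) ℂ[X] :=
  D.form.map (formPoly h)

theorem formMatrix_apply (D : Connection (chart r s t)) (i j : Fin 2) :
    formMatrix h D i j = formPoly h (D.form i j) := rfl

theorem natDegree_formMatrix_le (D : Connection (chart r s t)) (i j : Fin 2) :
    (formMatrix h D i j).natDegree ≤ 1 := natDegree_formPoly_le h _

theorem quadPoly_det (D : Connection (chart r s t)) :
    quadPoly h D.det = (formMatrix h D).det := by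
  rw [Connection.det, map_sub, quadPoly_tmul, quadPoly_tmul, Matrix.det_fin_two]
  rfl

theorem traceFree_iff_formMatrix (D : Connection (chart r s t)) :
    D.TraceFree ↔ formMatrix h D 1 1 = -formMatrix h D 0 0 := by
  rw [D.traceFree_iff, formMatrix_apply, formMatrix_apply, ← map_neg, (formPoly_injective h).eq_iff]

theorem coef_toMap (D : Connection (chart r s t)) (v : Fin 2 → FunctionField r s t) (i : Fin 2) :
    coef r s t (D.toMap v i) = deriv r s t (v i) +
      (v 0 * evX r s t (formMatrix h D i 0) + v 1 * evX r s t (formMatrix h D i 1)) := by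
  rw [D.toMap_apply, map_add, map_add, map_smul, map_smul, coef_D, coef_eq_evX_formPoly h,
    coef_eq_evX_formPoly h]
  rfl

/-- The matrix `M` has a constant eigenvector. -/
def HasEigenline (M : Matrix (Fin 2) (Fin 2) ℂ[X]) : Prop :=
  ∃ v : Fin 2 → ℂ, v ≠ 0 ∧ ∃ μ : ℂ[X], ∀ i, C (v 0) * M i 0 + C (v 1) * M i 1 = C (v i) * μ

/-- An invariant line subbundle of the trivial bundle is constant. -/
theorem hasEigenline_of_not_irreducible {D : Connection (chart r s t)} (hD : D.TraceFree)
    (hirr : ¬ D.Irreducible) : HasEigenline (formMatrix h D) := by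
  rw [Connection.Irreducible, not_not] at hirr
  obtain ⟨l, hl, hinv⟩ := hirr
  -- A generator of the line, with denominators cleared so that it is a section over the affine
  -- chart; invariance is needed on that chart only.
  obtain ⟨w, hw0, hwl, hws, hspan⟩ : ∃ w : Fin 2 → FunctionField r s t, w ≠ 0 ∧ w ∈ l ∧
      IsSection (chart r s t) 0 w ∧ ∀ z ∈ l, ∃ g : FunctionField r s t, g • w = z := by
    obtain ⟨w, hw0, hspan⟩ := finrank_eq_one_iff'.1 hl
    obtain ⟨d, p, q, hd, e⟩ := exists_evX_mul_eq ((w : Fin 2 → FunctionField r s t) 0)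
    obtain ⟨d', p', q', hd', e'⟩ := exists_evX_mul_eq ((w : Fin 2 → FunctionField r s t) 1)
    have hm := evX_ne_zero (r := r) (s := s) (t := t) (mul_ne_zero hd hd')
    refine ⟨evX r s t (d * d') • w, smul_ne_zero hm (by simpa using hw0), l.smul_mem _ w.2, ?_, ?_⟩
    · intro i
      rw [mem_chart_zero_iff]
      fin_cases i
      · refine ⟨d' * p, d' * q, ?_⟩
        simp only [Pi.smul_apply, smul_eq_mul, map_mul, Fin.zero_eta]
        linear_combination evX r s t d' * e
      · refine ⟨d * p', d * q', ?_⟩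
        simp only [Pi.smul_apply, smul_eq_mul, map_mul, Fin.mk_one]
        linear_combination evX r s t d * e'
    · intro z hz
      obtain ⟨g, hg⟩ := hspan ⟨z, hz⟩
      refine ⟨g * (evX r s t (d * d'))⁻¹, ?_⟩
      rw [smul_smul, mul_assoc, inv_mul_cancel₀ hm, mul_one]
      exact congrArg Subtype.val hg
  obtain ⟨η, hη⟩ : ∃ η, D.toMap w = fun i => w i • η := by
    have := hinv 0 w hwl hws
    generalize D.toMap w = z at this
    induction this using Submodule.span_induction with
    | mem z hz =>
      obtain ⟨w', hw', -, ω, -, rfl⟩ := hz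
      obtain ⟨g, rfl⟩ := hspan w' hw'
      exact ⟨g • ω, by funext i; rw [Pi.smul_apply, smul_eq_mul, smul_smul, mul_comm]⟩
    | zero => exact ⟨0, by funext i; simp⟩
    | add a b _ _ ha hb =>
      obtain ⟨η, rfl⟩ := ha
      obtain ⟨η', rfl⟩ := hb
      exact ⟨η + η', by funext i; simp⟩
    | smul z a _ ha =>
      obtain ⟨η, rfl⟩ := ha
      exact ⟨z • η, by funext i; simp only [Pi.smul_apply]; rw [smul_comm]⟩
  have hcoef : ∀ i, deriv r s t (w i) + (w 0 * evX r s t (formMatrix h D i 0) +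
      w 1 * evX r s t (formMatrix h D i 1)) = w i * coef r s t η := fun i => by
    rw [← coef_toMap, hη, map_smul, smul_eq_mul]
  rw [traceFree_iff_formMatrix h] at hD
  have c0 := hcoef 0
  have c1 := hcoef 1
  -- Either the line has infinite slope and is spanned by the second basis vector, or its slope w 1
  -- / w 0 solves the Riccati equation.
  by_cases h0 : w 0 = 0
  · have h1 : w 1 ≠ 0 := by
      intro h1
      refine hw0 (funext fun i => ?_)
      fin_cases i
      · exact h0
      · exact h1
    rw [h0, map_zero, zero_mul, zero_mul, zero_add, zero_add] at c0
    have hM : formMatrix h D 0 1 = 0 := evX_injective (r := r) (s := s) (t := t) (by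
      rw [map_zero]; exact (mul_eq_zero.1 c0).resolve_left h1)
    refine ⟨![0, 1], by simp, formMatrix h D 1 1, fun i => ?_⟩
    fin_cases i <;> simp [hM]
  · have hric : deriv r s t (w 1 / w 0) = -evX r s t (formMatrix h D 1 0) +
        2 * evX r s t (formMatrix h D 0 0) * (w 1 / w 0) +
        evX r s t (formMatrix h D 0 1) * (w 1 / w 0) ^ 2 := by
      rw [hD, map_neg] at c1
      rw [Derivation.leibniz_div]
      simp only [smul_eq_mul]
      field_simp
      linear_combination w 0 * c1 - w 1 * c0
    obtain ⟨z, hz⟩ := exists_algebraMap_eq_of_deriv_eq h (natDegree_formMatrix_le h D 0 0)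
      (natDegree_formMatrix_le h D 0 1) (natDegree_formMatrix_le h D 1 0) hric
    rw [hz, Derivation.map_algebraMap, algebraMap_eq_evX] at hric
    have hpoly : -formMatrix h D 1 0 + 2 * formMatrix h D 0 0 * C z +
        formMatrix h D 0 1 * C z ^ 2 = 0 := by
      refine evX_injective (r := r) (s := s) (t := t) ?_
      rw [map_zero, hric]
      simp only [map_add, map_mul, map_neg, map_pow, map_ofNat]
    refine ⟨![1, z], by simp, formMatrix h D 0 0 + C z * formMatrix h D 0 1, fun i => ?_⟩
    fin_cases i
    · simp
    · simp [hD]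
      linear_combination -hpoly

/-- The eigenvalue μ is a priori any polynomial. Dividing by a nonzero coordinate of v shows that it
comes from a holomorphic form. -/
theorem not_irreducible_of_hasEigenline {D : Connection (chart r s t)}
    (hM : HasEigenline (formMatrix h D)) : ¬ D.Irreducible := by
  obtain ⟨v, hv, μ, hμ⟩ := hM
  obtain ⟨k, hk⟩ := Function.ne_iff.1 hv
  simp only [Pi.zero_apply] at hk
  have e : μ = formPoly h ((v k)⁻¹ • (v 0 • D.form k 0 + v 1 • D.form k 1)) := by
    rw [map_smul, map_add, map_smul, map_smul, ← formMatrix_apply, ← formMatrix_apply,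
      smul_eq_C_mul, smul_eq_C_mul, smul_eq_C_mul, hμ, ← mul_assoc, ← C_mul, inv_mul_cancel₀ hk,
      C_1, one_mul]
  refine D.not_irreducible_of_eigenline hv
    (ω := (v k)⁻¹ • (v 0 • D.form k 0 + v 1 • D.form k 1)) fun i => formPoly_injective h ?_
  rw [map_smul (formPoly h) (v i), ← e, map_add, map_smul, map_smul, smul_eq_C_mul, smul_eq_C_mul,
    smul_eq_C_mul]
  exact hμ i

end

section

/-! ### Pencils of trace-free matrices -/

theorem exists_eq_of_natDegree_le_one {p : ℂ[X]} (hp : p.natDegree ≤ 1) :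
    ∃ a b : ℂ, p = C a + C b * X :=
  ⟨p.coeff 0, p.coeff 1, by
    conv_lhs => rw [eq_X_add_C_of_natDegree_le_one hp]
    exact add_comm _ _⟩

theorem coeff_quadratic (a b c : ℂ) : (C a + C b * X + C c * X ^ 2).coeff 0 = a ∧
    (C a + C b * X + C c * X ^ 2).coeff 1 = b ∧ (C a + C b * X + C c * X ^ 2).coeff 2 = c := by
  refine ⟨?_, ?_, ?_⟩ <;> simp [coeff_X, coeff_C]

theorem eq_quadratic_of_natDegree_le_two {p : ℂ[X]} (hp : p.natDegree ≤ 2) :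
    p = C (p.coeff 0) + C (p.coeff 1) * X + C (p.coeff 2) * X ^ 2 := by
  conv_lhs => rw [p.as_sum_range_C_mul_X_pow' (Nat.lt_succ_of_le hp)]
  simp [Finset.sum_range_succ]

/-- A normal form of a trace-free matrix with entries of degree at most `1` and determinant `q`. -/
def normalMatrix (q : ℂ[X]) (u : ℂ) : Matrix (Fin 2) (Fin 2) ℂ[X] :=
  !![C u * X, 1; -(C (q.coeff 0) + C (q.coeff 1) * X), -(C u * X)]

theorem det_normalMatrix {q : ℂ[X]} (hq : q.natDegree ≤ 2) {u : ℂ} (hu : u ^ 2 = -q.coeff 2) :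
    (normalMatrix q u).det = q := by
  conv_rhs => rw [eq_quadratic_of_natDegree_le_two hq]
  have := congrArg C hu
  rw [C_pow, C_neg] at this
  rw [normalMatrix, Matrix.det_fin_two_of]
  linear_combination -X ^ 2 * this

theorem hasEigenline_normalMatrix (m n : ℂ) :
    HasEigenline (normalMatrix ((C m + C n * X) ^ 2) (Complex.I * n)) := by
  have e : (C m + C n * X) ^ 2 = C (m ^ 2) + C (2 * m * n) * X + C (n ^ 2) * X ^ 2 := by
    simp only [C_mul, C_pow, map_ofNat]; ring
  obtain ⟨e0, e1, -⟩ := coeff_quadratic (m ^ 2) (2 * m * n) (n ^ 2)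
  have hI : (C Complex.I : ℂ[X]) ^ 2 = -1 := by rw [← C_pow, Complex.I_sq, C_neg, C_1]
  -- For q = (m + nx)² the eigenvalues are ±i(m + nx); with u = in, the one with sign + has a
  -- constant eigenvector.
  refine ⟨![1, Complex.I * m], by simp, C Complex.I * (C m + C n * X), fun i => ?_⟩
  have h2 : (C 2 : ℂ[X]) = 2 := map_ofNat C 2
  rw [normalMatrix, e, e0, e1]
  fin_cases i
  · simp
    ring
  · simp [h2]
    linear_combination -(C m ^ 2 + 2 * C m * C n * X) * hI

theorem HasEigenline.of_conj {M N : Matrix (Fin 2) (Fin 2) ℂ[X]} {g : Matrix (Fin 2) (Fin 2) ℂ}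
    (hg : g.det ≠ 0) (h : M * g.map C = g.map C * N) (hN : HasEigenline N) : HasEigenline M := by
  obtain ⟨v, hv, μ, hμ⟩ := hN
  refine ⟨g.mulVec v, ?_, μ, fun i => ?_⟩
  · intro h0
    exact hg (Matrix.exists_mulVec_eq_zero_iff.1 ⟨v, hv, h0⟩)
  · have h0 := congrFun (congrFun h i) 0
    have h1 := congrFun (congrFun h i) 1
    simp only [Matrix.mul_apply, Fin.sum_univ_two, Matrix.map_apply] at h0 h1
    simp only [Matrix.mulVec, dotProduct, Fin.sum_univ_two, C_add, C_mul]
    linear_combination C (v 0) * h0 + C (v 1) * h1 + C (g i 0) * hμ 0 + C (g i 1) * hμ 1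

theorem det_eq_of_conj {M N : Matrix (Fin 2) (Fin 2) ℂ[X]} {g : Matrix (Fin 2) (Fin 2) ℂ}
    (hg : g.det ≠ 0) (h : M * g.map C = g.map C * N) : M.det = N.det := by
  have := congrArg Matrix.det h
  have hC : (g.map C).det = C g.det := (RingHom.map_det C g).symm
  rw [Matrix.det_mul, Matrix.det_mul, hC, mul_comm] at this
  exact mul_left_cancel₀ (C_ne_zero.2 hg) this

/-- Write M = M₀ + x M₁ and choose v ≠ 0 with M₁ v = -u v. The columns of g are M₀ v and v.
Cayley-Hamilton gives M₀² = -q₀ and M₀ M₁ + M₁ M₀ = -q₁, which produce the first column of the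
normal form. If g were singular, M₀ v would be proportional to v and v would be a common
eigenvector. -/
theorem exists_conj_normalMatrix {M : Matrix (Fin 2) (Fin 2) ℂ[X]}
    (hM : ∀ i j, (M i j).natDegree ≤ 1) (htr : M 1 1 = -M 0 0) (hirr : ¬ HasEigenline M) {u : ℂ}
    (hu : u ^ 2 = -M.det.coeff 2) :
    ∃ g : Matrix (Fin 2) (Fin 2) ℂ, g.det ≠ 0 ∧
      M * g.map C = g.map C * normalMatrix M.det u := by
  obtain ⟨a, a', ha⟩ := exists_eq_of_natDegree_le_one (hM 0 0)
  obtain ⟨b, b', hb⟩ := exists_eq_of_natDegree_le_one (hM 0 1)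
  obtain ⟨c, c', hc⟩ := exists_eq_of_natDegree_le_one (hM 1 0)
  have hdet : M.det = C (-(a ^ 2 + b * c)) + C (-(2 * a * a' + b * c' + b' * c)) * X +
      C (-(a' ^ 2 + b' * c')) * X ^ 2 := by
    rw [Matrix.det_fin_two, htr, ha, hb, hc]
    simp only [C_add, C_mul, C_neg, C_pow, map_ofNat]
    ring
  obtain ⟨e0, e1, e2⟩ := coeff_quadratic (-(a ^ 2 + b * c)) (-(2 * a * a' + b * c' + b' * c))
    (-(a' ^ 2 + b' * c'))
  rw [hdet, e2] at hu
  obtain ⟨v, hv, hv'⟩ := Matrix.exists_mulVec_eq_zero_iff (M := !![a' + u, b'; c', u - a']).2 (by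
    rw [Matrix.det_fin_two_of]
    linear_combination hu)
  have v0 := congrFun hv' 0
  have v1 := congrFun hv' 1
  simp [Matrix.mulVec, dotProduct, Fin.sum_univ_two] at v0 v1
  have w0 := congrArg C v0
  have w1 := congrArg C v1
  simp only [C_add, C_mul, C_sub, C_0] at w0 w1
  refine ⟨!![a * v 0 + b * v 1, v 0; c * v 0 - a * v 1, v 1], ?_, ?_⟩
  · intro hg
    rw [Matrix.det_fin_two_of] at hg
    obtain ⟨k, hk0, hk1⟩ : ∃ k, a * v 0 + b * v 1 = k * v 0 ∧ c * v 0 - a * v 1 = k * v 1 := by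
      by_cases h0 : v 0 = 0
      · have h1 : v 1 ≠ 0 := by
          intro h1
          refine hv (funext fun i => ?_)
          fin_cases i
          · exact h0
          · exact h1
        refine ⟨-a, ?_, by rw [h0]; ring⟩
        rw [h0] at hg ⊢
        have : b * v 1 * v 1 = 0 := by linear_combination hg
        have : b * v 1 = 0 := (mul_eq_zero.1 this).resolve_right h1
        linear_combination this
      · refine ⟨(a * v 0 + b * v 1) / v 0, by field_simp, ?_⟩
        field_simp
        linear_combination -hg
    have l0 := congrArg C hk0
    have l1 := congrArg C hk1
    simp only [C_add, C_mul, C_sub] at l0 l1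
    refine hirr ⟨v, hv, C k - C u * X, fun i => ?_⟩
    fin_cases i
    · simp [ha, hb]
      linear_combination l0 + X * w0
    · simp [ha, hc, htr]
      linear_combination l1 + X * w1
  · have h2 : (C 2 : ℂ[X]) = 2 := map_ofNat C 2
    rw [normalMatrix, hdet, e0, e1]
    ext1 i j
    fin_cases i <;> fin_cases j <;>
      simp [Matrix.mul_apply, Fin.sum_univ_two, ha, hb, hc, htr, h2]
    · linear_combination -C a * X * w0 - C b * X * w1
    · linear_combination X * w0
    · linear_combination -C c * X * w0 + C a * X * w1
    · linear_combination X * w1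

/-- A trace-free matrix with entries of degree at most `1` has a constant eigenvector if and only
if its determinant is a square. -/
theorem hasEigenline_iff {M : Matrix (Fin 2) (Fin 2) ℂ[X]}
    (hM : ∀ i j, (M i j).natDegree ≤ 1) (htr : M 1 1 = -M 0 0) :
    HasEigenline M ↔ ∃ p : ℂ[X], p.natDegree ≤ 1 ∧ M.det = p ^ 2 := by
  constructor
  · rintro ⟨v, hv, μ, hμ⟩
    have h0 := hμ 0
    have h1 := hμ 1
    rw [htr] at h1
    -- The eigenvalues are μ and -μ, so the determinant is -μ².
    have hdet : M.det = (C Complex.I * μ) ^ 2 := by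
      rw [mul_pow, ← C_pow, Complex.I_sq, Matrix.det_fin_two, htr]
      obtain ⟨k, hk⟩ := Function.ne_iff.1 hv
      refine mul_left_cancel₀ (C_ne_zero.2 hk) ?_
      rw [C_neg, C_1]
      fin_cases k
      · change C (v 0) * _ = C (v 0) * _
        linear_combination -M 0 1 * h1 - (M 0 0 + μ) * h0
      · change C (v 1) * _ = C (v 1) * _
        linear_combination -M 1 0 * h0 + (M 0 0 - μ) * h1
    refine ⟨_, ?_, hdet⟩
    have hle : M.det.natDegree ≤ 2 := by
      rw [Matrix.det_fin_two]
      exact natDegree_sub_le_of_le (natDegree_mul_le_of_le (hM 0 0) (hM 1 1))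
        (natDegree_mul_le_of_le (hM 0 1) (hM 1 0))
    rw [hdet, natDegree_pow] at hle
    omega
  · rintro ⟨p, hp, hdet⟩
    by_contra hirr
    obtain ⟨m, n, rfl⟩ := exists_eq_of_natDegree_le_one hp
    have e : (C m + C n * X) ^ 2 = C (m ^ 2) + C (2 * m * n) * X + C (n ^ 2) * X ^ 2 := by
      simp only [C_mul, C_pow, map_ofNat]; ring
    -- The root u = in is the one for which the normal form of a square visibly has an eigenline;
    -- conjugation carries it back to M.
    obtain ⟨g, hg, hconj⟩ := exists_conj_normalMatrix hM htr hirr (u := Complex.I * n) (by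
      rw [hdet, e, (coeff_quadratic _ _ _).2.2, mul_pow, Complex.I_sq]; ring)
    rw [hdet] at hconj
    exact hirr (HasEigenline.of_conj hg hconj (hasEigenline_normalMatrix m n))

variable {r s t : ℂ} (h : ([0, 1, r, s, t] : List ℂ).Nodup)

/-! ### Isomorphism classes -/

/-- A constant invertible matrix preserves sections over both charts and commutes with d, so the
gauge transformation reduces to conjugation. -/
theorem isomorphic_of_conj {D D' : Connection (chart r s t)} {g : Matrix (Fin 2) (Fin 2) ℂ}
    (hg : g.det ≠ 0) (hconj : formMatrix h D' * g.map C = g.map C * formMatrix h D) :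
    D.Isomorphic D' := by
  set G : Matrix (Fin 2) (Fin 2) (FunctionField r s t) := g.map (algebraMap ℂ _) with hG
  have hGdet : G.det ≠ 0 := by
    have : G.det = algebraMap ℂ (FunctionField r s t) g.det :=
      (RingHom.map_det (algebraMap ℂ (FunctionField r s t)) g).symm
    rw [this]
    exact (_root_.map_ne_zero _).2 hg
  have hsec : ∀ (c : Fin 2) (k : Matrix (Fin 2) (Fin 2) ℂ) (v : Fin 2 → FunctionField r s t),
      IsSection (chart r s t) c v →
      IsSection (chart r s t) c ((k.map (algebraMap ℂ (FunctionField r s t))).mulVec v) :=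
    fun c k v hv i => by
      rw [Matrix.mulVec, dotProduct]
      exact sum_mem fun j _ => mul_mem (algebraMap_mem (chart r s t c) (k i j)) (hv j)
  refine ⟨Matrix.GeneralLinearGroup.mkOfDetNeZero G hGdet, fun c v => ⟨fun hv => ?_, fun hv => ?_⟩,
    fun v => ?_⟩
  · have := hsec c g⁻¹ _ hv
    change IsSection _ c (Matrix.mulVec _ (G.mulVec v)) at this
    rw [Matrix.mulVec_mulVec, hG, ← Matrix.map_mul, Matrix.nonsing_inv_mul _ hg.isUnit,
      Matrix.map_one _ (map_zero _) (map_one _), Matrix.one_mulVec] at this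
    exact this
  · exact hsec c g v hv
  · funext i
    refine (coef r s t).injective ?_
    change coef r s t (D'.toMap (G.mulVec v) i) = coef r s t (∑ j, G i j • D.toMap v j)
    have h0 := congrArg (evX r s t) (congrFun (congrFun hconj i) 0)
    have h1 := congrArg (evX r s t) (congrFun (congrFun hconj i) 1)
    simp only [Matrix.mul_apply, Fin.sum_univ_two, Matrix.map_apply, map_add, map_mul,
      ← algebraMap_eq_evX] at h0 h1
    rw [coef_toMap h, Fin.sum_univ_two, map_add, map_smul, map_smul, coef_toMap h, coef_toMap h]
    simp only [Matrix.mulVec, dotProduct, Fin.sum_univ_two, hG, Matrix.map_apply, map_add,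
      Derivation.leibniz, Derivation.map_algebraMap, smul_eq_mul, mul_zero, add_zero]
    linear_combination v 0 * h0 + v 1 * h1

/-- The entries of a bundle automorphism are regular on both charts, hence constant, so the
isomorphism is a conjugation of pencils. -/
theorem det_eq_of_isomorphic (h : ([0, 1, r, s, t] : List ℂ).Nodup)
    {D D' : Connection (chart r s t)} (hD : D.Isomorphic D') :
    D.det = D'.det := by
  obtain ⟨G, hG, hGD⟩ := hD
  have hz : ∀ i j, ∃ z : ℂ, (G : Matrix (Fin 2) (Fin 2) (FunctionField r s t)) i j =
      algebraMap ℂ _ z := fun i j => by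
    refine exists_algebraMap_eq_of_mem h fun c => ?_
    have := (hG c (Pi.single j 1)).2 (fun k => by
      rcases eq_or_ne k j with rfl | hk
      · simp
      · simp [Pi.single_eq_of_ne hk]) i
    rwa [Matrix.mulVec_single_one] at this
  choose g hg using hz
  have hgG : (G : Matrix (Fin 2) (Fin 2) (FunctionField r s t)) =
      (Matrix.of g).map (algebraMap ℂ _) := Matrix.ext hg
  have hdet : (Matrix.of g).det ≠ 0 := by
    intro h0
    have : (G : Matrix (Fin 2) (Fin 2) (FunctionField r s t)).det =
        algebraMap ℂ (FunctionField r s t) (Matrix.of g).det := by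
      rw [hgG]
      exact (RingHom.map_det (algebraMap ℂ (FunctionField r s t)) (Matrix.of g)).symm
    rw [h0, map_zero] at this
    exact (Matrix.isUnit_iff_isUnit_det _).1 G.isUnit |>.ne_zero this
  refine quadPoly_injective h ?_
  rw [quadPoly_det, quadPoly_det]
  refine (det_eq_of_conj hdet ?_).symm
  ext1 i j
  refine evX_injective (r := r) (s := s) (t := t) ?_
  have key := congrArg (coef r s t) (congrFun (hGD (Pi.single j 1)) i)
  rw [Matrix.mulVec_single_one, formAct, Fin.sum_univ_two, map_add, map_smul, map_smul, coef_toMap h,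
    coef_toMap h, coef_toMap h] at key
  simp only [Matrix.col_apply, hg, Derivation.map_algebraMap, smul_eq_mul] at key
  simp only [Matrix.mul_apply, Fin.sum_univ_two, Matrix.map_apply, map_add, map_mul,
    ← algebraMap_eq_evX, Matrix.of_apply]
  fin_cases j
  · simp at key ⊢
    linear_combination key
  · simp at key ⊢
    linear_combination key

theorem exists_conj_of_irreducible {D : Connection (chart r s t)} (hD : D.TraceFree)
    (hirr : D.Irreducible) {u : ℂ} (hu : u ^ 2 = -(quadPoly h D.det).coeff 2) :
    ∃ g : Matrix (Fin 2) (Fin 2) ℂ, g.det ≠ 0 ∧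
      formMatrix h D * g.map C = g.map C * normalMatrix (quadPoly h D.det) u := by
  rw [quadPoly_det] at hu ⊢
  exact exists_conj_normalMatrix (natDegree_formMatrix_le h D) ((traceFree_iff_formMatrix h D).1 hD)
    (fun hM => not_irreducible_of_hasEigenline h hM hirr) hu

/-- Both pencils are conjugate to the same normal form once one root u is used for both. -/
theorem isomorphic_of_det_eq (h : ([0, 1, r, s, t] : List ℂ).Nodup)
    {D D' : Connection (chart r s t)} (hD : D.TraceFree)
    (hirr : D.Irreducible) (hD' : D'.TraceFree) (hirr' : D'.Irreducible) (e : D.det = D'.det) :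
    D.Isomorphic D' := by
  obtain ⟨u, hu⟩ := IsAlgClosed.exists_pow_nat_eq (-(quadPoly h D.det).coeff 2) two_pos
  obtain ⟨g, hg, hgD⟩ := exists_conj_of_irreducible h hD hirr hu
  rw [e] at hu
  obtain ⟨g', hg', hgD'⟩ := exists_conj_of_irreducible h hD' hirr' hu
  rw [← e] at hgD'
  refine isomorphic_of_conj h (g := g' * g⁻¹) ?_ ?_
  · rw [Matrix.det_mul]
    exact mul_ne_zero hg' (by rw [Matrix.det_nonsing_inv]; simpa using hg)
  · have h1 : g.map C * g⁻¹.map C = 1 := by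
      rw [← Matrix.map_mul, Matrix.mul_nonsing_inv _ hg.isUnit,
        Matrix.map_one _ (map_zero _) (map_one _)]
    have h2 : g⁻¹.map C * g.map C = 1 := by
      rw [← Matrix.map_mul, Matrix.nonsing_inv_mul _ hg.isUnit,
        Matrix.map_one _ (map_zero _) (map_one _)]
    have h3 : normalMatrix (quadPoly h D.det) u * g⁻¹.map C = g⁻¹.map C * formMatrix h D := by
      calc _ = g⁻¹.map C * (g.map C * normalMatrix (quadPoly h D.det) u) * g⁻¹.map C := by
            rw [← mul_assoc, h2, one_mul]
        _ = _ := by rw [← hgD, mul_assoc, mul_assoc, h1, mul_one]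
    rw [Matrix.map_mul, ← mul_assoc, hgD', mul_assoc, h3, mul_assoc]

theorem mem_nonSquares_iff_quadPoly (q : HolQuad (chart r s t)) :
    q ∈ nonSquares (chart r s t) ↔ ¬ ∃ p : ℂ[X], p.natDegree ≤ 1 ∧ quadPoly h q = p ^ 2 := by
  refine not_congr ⟨?_, ?_⟩
  · rintro ⟨ω, rfl⟩
    exact ⟨formPoly h ω, natDegree_formPoly_le h ω, by rw [quadPoly_tmul, sq]⟩
  · rintro ⟨p, hp, e⟩
    obtain ⟨ω, rfl⟩ := exists_formPoly_eq h hp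
    exact ⟨ω, quadPoly_injective h (by rw [quadPoly_tmul, e, sq])⟩

theorem mem_nonSquares_iff (q : HolQuad (chart r s t)) :
    q ∈ nonSquares (chart r s t) ↔
      (quadPoly h q).coeff 1 ^ 2 - 4 * (quadPoly h q).coeff 0 * (quadPoly h q).coeff 2 ≠ 0 := by
  rw [mem_nonSquares_iff_quadPoly h]
  refine not_congr ⟨?_, fun e => ?_⟩
  · rintro ⟨p, hp, e⟩
    obtain ⟨m, n, rfl⟩ := exists_eq_of_natDegree_le_one hp
    have e' : (C m + C n * X) ^ 2 = C (m ^ 2) + C (2 * m * n) * X + C (n ^ 2) * X ^ 2 := by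
      simp only [C_mul, C_pow, map_ofNat]; ring
    obtain ⟨e0, e1, e2⟩ := coeff_quadratic (m ^ 2) (2 * m * n) (n ^ 2)
    rw [e, e', e0, e1, e2]
    ring
  · obtain ⟨m, hm⟩ := IsAlgClosed.exists_pow_nat_eq ((quadPoly h q).coeff 0) two_pos
    obtain ⟨n, hn⟩ := IsAlgClosed.exists_pow_nat_eq ((quadPoly h q).coeff 2) two_pos
    -- Vanishing of the discriminant only gives q₁ = ±2mn; the sign of n is adjusted.
    obtain ⟨n', hn', hmn⟩ : ∃ n', n' ^ 2 = (quadPoly h q).coeff 2 ∧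
        2 * m * n' = (quadPoly h q).coeff 1 := by
      rw [← hm, ← hn] at e
      rcases eq_or_eq_neg_of_sq_eq_sq (a := (quadPoly h q).coeff 1) (b := 2 * m * n)
        (by linear_combination e) with e | e
      · exact ⟨n, hn, e.symm⟩
      · exact ⟨-n, by rw [neg_sq, hn], by rw [e]; ring⟩
    refine ⟨C m + C n' * X, natDegree_add_le_of_degree_le ((natDegree_C m).trans_le zero_le_one)
      ((natDegree_C_mul_le _ _).trans natDegree_X_le), ?_⟩
    rw [eq_quadratic_of_natDegree_le_two (natDegree_quadPoly_le h q), ← hm, ← hn', ← hmn]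
    simp only [C_mul, C_pow, map_ofNat]
    ring

theorem irreducible_iff (h : ([0, 1, r, s, t] : List ℂ).Nodup)
    {D : Connection (chart r s t)} (hD : D.TraceFree) :
    D.Irreducible ↔ D.det ∈ nonSquares (chart r s t) := by
  rw [mem_nonSquares_iff_quadPoly h, quadPoly_det, ← hasEigenline_iff (natDegree_formMatrix_le h D)
    ((traceFree_iff_formMatrix h D).1 hD)]
  exact ⟨fun hirr hM => not_irreducible_of_hasEigenline h hM hirr, fun hM =>
    not_imp_comm.1 (hasEigenline_of_not_irreducible h hD) hM⟩

end

section

/-! ### Polynomial functions and the Zariski topology -/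

section Zariski

variable {V W : Type*} [AddCommGroup V] [Module ℂ V] [AddCommGroup W] [Module ℂ W]

theorem dual_mem_polyFun (φ : Module.Dual ℂ V) : (φ : V → ℂ) ∈ polyFun V :=
  Algebra.subset_adjoin ⟨φ, rfl⟩

theorem comp_mem_polyFun {T : V → W}
    (hT : ∀ φ : Module.Dual ℂ W, (fun v => φ (T v)) ∈ polyFun V) {p : W → ℂ} (hp : p ∈ polyFun W) :
    (fun v => p (T v)) ∈ polyFun V := by
  induction hp using Algebra.adjoin_induction with
  | mem z hz =>
    obtain ⟨φ, rfl⟩ := hz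
    exact hT φ
  | algebraMap z => exact algebraMap_mem (polyFun V) z
  | add a b _ _ ha hb => exact add_mem ha hb
  | mul a b _ _ ha hb => exact mul_mem ha hb

theorem isOpen_zariski_iff {U : Set V} :
    @IsOpen V (zariski V) U ↔ ∀ v ∈ U, ∃ p ∈ polyFun V, p v ≠ 0 ∧ ∀ w, p w ≠ 0 → w ∈ U := by
  constructor
  · intro hU
    induction hU with
    | basic U hU =>
      obtain ⟨p, hp, rfl⟩ := hU
      exact fun v hv => ⟨p, hp, hv, fun w hw => hw⟩
    | univ => exact fun v _ => ⟨1, one_mem _, one_ne_zero, fun w _ => trivial⟩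
    | inter U U' _ _ ih ih' =>
      rintro v ⟨hv, hv'⟩
      obtain ⟨p, hp, hpv, hpU⟩ := ih v hv
      obtain ⟨p', hp', hpv', hpU'⟩ := ih' v hv'
      exact ⟨p * p', mul_mem hp hp', mul_ne_zero hpv hpv', fun w hw =>
        ⟨hpU w (left_ne_zero_of_mul hw), hpU' w (right_ne_zero_of_mul hw)⟩⟩
    | sUnion S _ ih =>
      rintro v ⟨U, hU, hv⟩
      obtain ⟨p, hp, hpv, hpU⟩ := ih U hU v hv
      exact ⟨p, hp, hpv, fun w hw => ⟨U, hU, hpU w hw⟩⟩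
  · intro hU
    let := zariski V
    refine isOpen_iff_forall_mem_open.2 fun v hv => ?_
    obtain ⟨p, hp, hpv, hpU⟩ := hU v hv
    exact ⟨{w | p w ≠ 0}, hpU, TopologicalSpace.isOpen_generateFrom_of_mem ⟨p, hp, rfl⟩, hpv⟩

end Zariski

variable {r s t : ℂ} (h : ([0, 1, r, s, t] : List ℂ).Nodup)

/-! ### The determinant as a polynomial map -/

theorem exists_quadPoly_eq {p : ℂ[X]} (hp : p.natDegree ≤ 2) : ∃ q, quadPoly h q = p := by
  have e := (coefQuad r s t).apply_symm_apply (evX r s t p)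
  exact ⟨⟨(coefQuad r s t).symm (evX r s t p), (mem_holQuad_iff h _).2 ⟨p, hp, e⟩⟩,
    evX_injective (by rw [← coefQuad_eq_evX_quadPoly, e])⟩

theorem coeff_formPoly_mem_polyFun (i j : Fin 2) (k : ℕ) :
    (fun θ : Matrix (Fin 2) (Fin 2) (HolForm (chart r s t)) => (formPoly h (θ i j)).coeff k) ∈
      polyFun (Matrix (Fin 2) (Fin 2) (HolForm (chart r s t))) :=
  dual_mem_polyFun (lcoeff ℂ k ∘ₗ formPoly h ∘ₗ Matrix.entryLinearMap ℂ _ i j)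

theorem coeff_quadPoly_mem_polyFun (k : ℕ) :
    (fun q : HolQuad (chart r s t) => (quadPoly h q).coeff k) ∈ polyFun (HolQuad (chart r s t)) :=
  dual_mem_polyFun (lcoeff ℂ k ∘ₗ quadPoly h)

/-- The determinant of a matrix of holomorphic `1`-forms. -/
def detForm (θ : Matrix (Fin 2) (Fin 2) (HolForm (chart r s t))) : HolQuad (chart r s t) :=
  HolForm.tmul (θ 0 0) (θ 1 1) - HolForm.tmul (θ 0 1) (θ 1 0)

/-- It suffices to treat linear functionals. Expanding in the basis xᵏ (dx/y)², k ≤ 2, leaves the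
coefficients of det θ, which are quadratic in those of the entries. -/
theorem comp_detForm_mem_polyFun (h : ([0, 1, r, s, t] : List ℂ).Nodup)
    {p : HolQuad (chart r s t) → ℂ} (hp : p ∈ polyFun (HolQuad (chart r s t))) :
    (fun θ => p (detForm θ)) ∈ polyFun (Matrix (Fin 2) (Fin 2) (HolForm (chart r s t))) := by
  refine comp_mem_polyFun (fun φ => ?_) hp
  have hX : ∀ k ∈ Finset.range 3, (X ^ k : ℂ[X]).natDegree ≤ 2 := fun k hk => by
    rw [natDegree_X_pow]; exact Nat.lt_succ_iff.1 (Finset.mem_range.1 hk)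
  choose e he using fun k hk => exists_quadPoly_eq h (hX k hk)
  have hq : ∀ q : HolQuad (chart r s t),
      q = ∑ k ∈ (Finset.range 3).attach, (quadPoly h q).coeff k • e k k.2 := fun q => by
    refine quadPoly_injective h ?_
    simp only [map_sum, map_smul, he, smul_eq_C_mul]
    rw [Finset.sum_attach (Finset.range 3) fun k => C ((quadPoly h q).coeff k) * X ^ k]
    exact (quadPoly h q).as_sum_range_C_mul_X_pow' (Nat.lt_succ_of_le (natDegree_quadPoly_le h q))
  have hdet : ∀ k, (fun θ : Matrix (Fin 2) (Fin 2) (HolForm (chart r s t)) =>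
      (quadPoly h (detForm θ)).coeff k) ∈ polyFun _ := fun k => by
    have : (fun θ : Matrix (Fin 2) (Fin 2) (HolForm (chart r s t)) =>
        (quadPoly h (detForm θ)).coeff k) = ∑ x ∈ Finset.HasAntidiagonal.antidiagonal k,
          ((fun θ => (formPoly h (θ 0 0)).coeff x.1) * (fun θ => (formPoly h (θ 1 1)).coeff x.2) -
          (fun θ => (formPoly h (θ 0 1)).coeff x.1) * (fun θ => (formPoly h (θ 1 0)).coeff x.2)) := by
      funext θ
      simp only [detForm, map_sub, quadPoly_tmul, coeff_sub, coeff_mul, Finset.sum_apply,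
        Pi.sub_apply, Pi.mul_apply, Finset.sum_sub_distrib]
    rw [this]
    exact sum_mem fun x _ => sub_mem
      (mul_mem (coeff_formPoly_mem_polyFun h _ _ _) (coeff_formPoly_mem_polyFun h _ _ _))
      (mul_mem (coeff_formPoly_mem_polyFun h _ _ _) (coeff_formPoly_mem_polyFun h _ _ _))
  have : (fun θ : Matrix (Fin 2) (Fin 2) (HolForm (chart r s t)) => φ (detForm θ)) =
      ∑ k ∈ (Finset.range 3).attach, φ (e k k.2) •
        (fun θ => (quadPoly h (detForm θ)).coeff k) := by
    funext θ
    conv_lhs => rw [hq (detForm θ)]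
    simp only [map_sum, map_smul, Finset.sum_apply, Pi.smul_apply, smul_eq_mul, mul_comm]
  rw [this]
  exact sum_mem fun k _ => Subalgebra.smul_mem _ (hdet k) _

/-! ### The two-valued section of the determinant -/

/-- The holomorphic form `dx / y`. -/
def formOne : HolForm (chart r s t) :=
  (exists_formPoly_eq h (p := 1) (by simp)).choose

/-- The holomorphic form `x dx / y`. -/
def formX : HolForm (chart r s t) :=
  (exists_formPoly_eq h (p := X) natDegree_X_le).choose

theorem formPoly_formOne : formPoly h (formOne h) = 1 :=
  (exists_formPoly_eq h (p := 1) (by simp)).choose_spec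

theorem formPoly_formX : formPoly h (formX h) = X :=
  (exists_formPoly_eq h (p := X) natDegree_X_le).choose_spec

/-- A trace-free matrix of holomorphic forms with determinant `q`, when `- u²` is the coefficient
of `x²` in `q`. -/
def normalForm (q : HolQuad (chart r s t)) (u : ℂ) :
    Matrix (Fin 2) (Fin 2) (HolForm (chart r s t)) :=
  !![u • formX h, formOne h;
    -((quadPoly h q).coeff 0 • formOne h + (quadPoly h q).coeff 1 • formX h), -(u • formX h)]

theorem map_normalForm (q : HolQuad (chart r s t)) (u : ℂ) :
    (normalForm h q u).map (formPoly h) = normalMatrix (quadPoly h q) u := by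
  ext1 i j
  fin_cases i <;> fin_cases j <;>
    simp [normalForm, normalMatrix, formPoly_formOne, formPoly_formX, smul_eq_C_mul]

/-- The normal form is affine in q₀, q₁, u, and u² = -q₂ is itself polynomial in q, so powers of u
above the first can be eliminated. -/
theorem exists_eq_comp_normalForm {P : Matrix (Fin 2) (Fin 2) (HolForm (chart r s t)) → ℂ}
    (hP : P ∈ polyFun (Matrix (Fin 2) (Fin 2) (HolForm (chart r s t)))) :
    ∃ p ∈ polyFun (HolQuad (chart r s t)), ∃ p' ∈ polyFun (HolQuad (chart r s t)),
      ∀ q u, u ^ 2 = -(quadPoly h q).coeff 2 → P (normalForm h q u) = p q + u * p' q := by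
  induction hP using Algebra.adjoin_induction with
  | mem z hz =>
    obtain ⟨φ, rfl⟩ := hz
    refine ⟨(fun q => (quadPoly h q).coeff 0) * algebraMap ℂ _ (φ !![0, 0; -formOne h, 0]) +
      (fun q => (quadPoly h q).coeff 1) * algebraMap ℂ _ (φ !![0, 0; -formX h, 0]) +
      algebraMap ℂ _ (φ !![0, formOne h; 0, 0]),
      add_mem (add_mem (mul_mem (coeff_quadPoly_mem_polyFun h 0) (algebraMap_mem _ _))
        (mul_mem (coeff_quadPoly_mem_polyFun h 1) (algebraMap_mem _ _))) (algebraMap_mem _ _),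
      algebraMap ℂ _ (φ !![formX h, 0; 0, -formX h]), algebraMap_mem _ _, fun q u _ => ?_⟩
    have e : normalForm h q u = (quadPoly h q).coeff 0 • !![0, 0; -formOne h, 0] +
        (quadPoly h q).coeff 1 • !![0, 0; -formX h, 0] + !![0, formOne h; 0, 0] +
        u • !![formX h, 0; 0, -formX h] := by
      ext1 i j
      fin_cases i <;> fin_cases j <;> simp [normalForm]
      abel
    rw [e]
    simp only [map_add, map_smul, smul_eq_mul]
    rfl
  | algebraMap z =>
    exact ⟨algebraMap ℂ _ z, algebraMap_mem _ _, 0, zero_mem _, fun q u _ => by simp⟩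
  | add a b _ _ ha hb =>
    obtain ⟨p, hp, p', hp', e⟩ := ha
    obtain ⟨m, hm, m', hm', e'⟩ := hb
    refine ⟨p + m, add_mem hp hm, p' + m', add_mem hp' hm', fun q u hu => ?_⟩
    simp only [Pi.add_apply]
    rw [e q u hu, e' q u hu]
    ring
  | mul a b _ _ ha hb =>
    obtain ⟨p, hp, p', hp', e⟩ := ha
    obtain ⟨m, hm, m', hm', e'⟩ := hb
    refine ⟨p * m - (fun q => (quadPoly h q).coeff 2) * (p' * m'),
      sub_mem (mul_mem hp hm) (mul_mem (coeff_quadPoly_mem_polyFun h 2) (mul_mem hp' hm')),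
      p * m' + p' * m, add_mem (mul_mem hp hm') (mul_mem hp' hm), fun q u hu => ?_⟩
    simp only [Pi.add_apply, Pi.mul_apply, Pi.sub_apply]
    rw [e q u hu, e' q u hu]
    linear_combination p' q * m' q * hu

theorem detForm_normalForm {q : HolQuad (chart r s t)} {u : ℂ}
    (hu : u ^ 2 = -(quadPoly h q).coeff 2) : detForm (normalForm h q u) = q := by
  refine quadPoly_injective h ?_
  have : quadPoly h (detForm (normalForm h q u)) = ((normalForm h q u).map (formPoly h)).det := by
    rw [detForm, map_sub, quadPoly_tmul, quadPoly_tmul, Matrix.det_fin_two]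
    rfl
  rw [this, map_normalForm, det_normalMatrix (natDegree_quadPoly_le h q) hu]

theorem det_ofForm_normalForm {q : HolQuad (chart r s t)} {u : ℂ}
    (hu : u ^ 2 = -(quadPoly h q).coeff 2) : (Connection.ofForm (normalForm h q u)).det = q := by
  change detForm (Connection.ofForm (normalForm h q u)).form = q
  rw [Connection.form_ofForm, detForm_normalForm h hu]

/-- The connection `d + θ` with `θ` in normal form. -/
def normalConnection (q : nonSquares (chart r s t)) (u : ℂ)
    (hu : u ^ 2 = -(quadPoly h q).coeff 2) : IrrConnection (chart r s t) :=
  have htr : (Connection.ofForm (normalForm h (q : HolQuad (chart r s t)) u)).TraceFree := by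
    rw [Connection.traceFree_iff, Connection.form_ofForm]
    rfl
  ⟨Connection.ofForm (normalForm h q u), htr, (irreducible_iff h htr).2 (by
    rw [det_ofForm_normalForm h hu]
    exact q.2)⟩

theorem form_normalConnection (q : nonSquares (chart r s t)) {u : ℂ}
    (hu : u ^ 2 = -(quadPoly h q).coeff 2) :
    (normalConnection h q u hu).form = normalForm h q u :=
  Connection.form_ofForm _

/-! ### The isomorphism -/

/-- The determinant of an irreducible trace-free connection. -/
def irrDet (D : IrrConnection (chart r s t)) : nonSquares (chart r s t) :=
  ⟨D.1.det, (irreducible_iff h D.2.1).1 D.2.2⟩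

theorem irrDet_normalConnection (q : nonSquares (chart r s t)) {u : ℂ}
    (hu : u ^ 2 = -(quadPoly h q).coeff 2) : irrDet h (normalConnection h q u hu) = q :=
  Subtype.ext (det_ofForm_normalForm h hu)

theorem exists_sq_eq (q : HolQuad (chart r s t)) : ∃ u : ℂ, u ^ 2 = -(quadPoly h q).coeff 2 :=
  IsAlgClosed.exists_pow_nat_eq _ two_pos

/-- The map induced by the determinant on isomorphism classes. -/
def moduliDet : Moduli (chart r s t) → nonSquares (chart r s t) :=
  Quotient.lift (irrDet h) fun _ _ hD => Subtype.ext (det_eq_of_isomorphic h hD)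

theorem moduliDet_mk (D : IrrConnection (chart r s t)) :
    moduliDet h (Moduli.mk D) = irrDet h D := rfl

theorem moduliDet_bijective : Function.Bijective (moduliDet h) := by
  constructor
  · rintro ⟨D⟩ ⟨D'⟩ e
    exact Quotient.sound (isomorphic_of_det_eq h D.2.1 D.2.2 D'.2.1 D'.2.2
      (congrArg Subtype.val e))
  · intro q
    obtain ⟨u, hu⟩ := exists_sq_eq h (q : HolQuad (chart r s t))
    exact ⟨Moduli.mk (normalConnection h q u hu), irrDet_normalConnection h q hu⟩

theorem continuous_irrDet : Continuous (irrDet h) := by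
  refine Continuous.subtype_mk (continuous_generateFrom_iff.2 ?_) _
  rintro _ ⟨p, hp, rfl⟩
  let : TopologicalSpace (Matrix (Fin 2) (Fin 2) (HolForm (chart r s t))) := zariski _
  exact ⟨{θ | p (detForm θ) ≠ 0}, TopologicalSpace.isOpen_generateFrom_of_mem
    ⟨_, comp_detForm_mem_polyFun h hp, rfl⟩, rfl⟩

theorem continuous_moduliDet : Continuous (moduliDet h) :=
  continuous_coinduced_dom.2 (continuous_irrDet h)

theorem isOpenMap_moduliDet : IsOpenMap (moduliDet h) := by
  intro V hV
  obtain ⟨O, hO, hOV⟩ := isOpen_coinduced.1 hV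
  -- Membership in O does not depend on the root u, since both normal forms lie over the same class.
  have hmem : ∀ (q : nonSquares (chart r s t)) (u : ℂ) (hu : u ^ 2 = -(quadPoly h q).coeff 2),
      normalForm h q u ∈ O ↔ q ∈ moduliDet h '' V := fun q u hu => by
    have e : IrrConnection.form ⁻¹' O = Moduli.mk ⁻¹' V := hOV
    rw [← form_normalConnection h q hu, ← Set.mem_preimage, e, Set.mem_preimage,
      ← (moduliDet_bijective h).1.mem_set_image, moduliDet_mk, irrDet_normalConnection]
  refine ⟨{q | ∃ u : ℂ, u ^ 2 = -(quadPoly h q).coeff 2 ∧ normalForm h q u ∈ O}, ?_, ?_⟩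
  · refine isOpen_zariski_iff.2 ?_
    rintro q ⟨u, hu, hq⟩
    obtain ⟨P, hP, hPq, hPO⟩ := isOpen_zariski_iff.1 hO _ hq
    obtain ⟨p, hp, p', hp', e⟩ := exists_eq_comp_normalForm h hP
    -- The values of P at v and -v have sum 2p and difference 2vp', so they cannot both vanish.
    have key : ∀ (a : HolQuad (chart r s t)) (v : ℂ), v ^ 2 = -(quadPoly h a).coeff 2 →
        (p a ≠ 0 ∨ v * p' a ≠ 0) →
        ∃ u : ℂ, u ^ 2 = -(quadPoly h a).coeff 2 ∧ normalForm h a u ∈ O := by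
      intro a v hv ha
      by_contra hcon
      have h1 : P (normalForm h a v) = 0 := by
        by_contra h1
        exact hcon ⟨v, hv, hPO _ h1⟩
      have h2 : P (normalForm h a (-v)) = 0 := by
        by_contra h2
        exact hcon ⟨-v, by rw [neg_sq, hv], hPO _ h2⟩
      rw [e a v hv] at h1
      rw [e a (-v) (by rw [neg_sq, hv])] at h2
      rcases ha with ha | ha
      · exact ha (by linear_combination (h1 + h2) / 2)
      · exact ha (by linear_combination (h1 - h2) / 2)
    rw [e q u hu] at hPq
    by_cases h0 : p q = 0
    · rw [h0, zero_add] at hPq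
      -- Here u p' ≠ 0 at q. Since q₂ = -u², q₂ p' is a polynomial in q detecting that both factors
      -- are nonzero.
      refine ⟨(fun a => (quadPoly h a).coeff 2) * p',
        mul_mem (coeff_quadPoly_mem_polyFun h 2) hp', ?_, fun a ha => ?_⟩
      · refine mul_ne_zero ?_ (right_ne_zero_of_mul hPq)
        rw [← neg_ne_zero, ← hu]
        exact pow_ne_zero _ (left_ne_zero_of_mul hPq)
      · obtain ⟨v, hv⟩ := exists_sq_eq h a
        refine key a v hv (Or.inr (mul_ne_zero ?_ (right_ne_zero_of_mul ha)))
        rintro rfl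
        refine left_ne_zero_of_mul ha ?_
        change (quadPoly h a).coeff 2 = 0
        linear_combination hv
    · refine ⟨p, hp, h0, fun a ha => ?_⟩
      obtain ⟨v, hv⟩ := exists_sq_eq h a
      exact key a v hv (Or.inl ha)
  · ext q
    constructor
    · rintro ⟨u, hu, hq⟩
      exact (hmem q u hu).1 hq
    · intro hq
      obtain ⟨u, hu⟩ := exists_sq_eq h (q : HolQuad (chart r s t))
      exact ⟨u, hu, (hmem q u hu).2 hq⟩

theorem isRegularOn_moduliDet {O : Set (nonSquares (chart r s t))}
    {f : nonSquares (chart r s t) → ℂ}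
    (hf : IsRegularOn (Subtype.val : nonSquares (chart r s t) → HolQuad (chart r s t)) O f) :
    Moduli.IsRegularOn (moduliDet h ⁻¹' O) (fun m => f (moduliDet h m)) := by
  intro D hD
  obtain ⟨p, hp, q, hq, hqD, hpq⟩ := hf _ hD
  exact ⟨_, comp_detForm_mem_polyFun h hp, _, comp_detForm_mem_polyFun h hq, hqD,
    fun D' hD' hqD' => hpq _ hD' hqD'⟩

theorem isRegularOn_of_moduliDet {O : Set (nonSquares (chart r s t))}
    {f : nonSquares (chart r s t) → ℂ}
    (hf : Moduli.IsRegularOn (moduliDet h ⁻¹' O) (fun m => f (moduliDet h m))) :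
    IsRegularOn (Subtype.val : nonSquares (chart r s t) → HolQuad (chart r s t)) O f := by
  intro a ha
  obtain ⟨u, hu⟩ := exists_sq_eq h (a : HolQuad (chart r s t))
  have hO : ∀ (b : nonSquares (chart r s t)) (v : ℂ) (hv : v ^ 2 = -(quadPoly h b).coeff 2),
      b ∈ O → normalConnection h b v hv ∈ Moduli.mk ⁻¹' (moduliDet h ⁻¹' O) := by
    intro b v hv hb
    change irrDet h _ ∈ O
    rwa [irrDet_normalConnection]
  obtain ⟨P, hP, Q, hQ, hQa, hPQ⟩ := hf _ (hO a u hu ha)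
  rw [form_normalConnection] at hQa
  -- PQ and Q² replace P and Q because Q² f = PQ holds also where Q vanishes, so it can be used at
  -- both roots v and -v at once.
  obtain ⟨p, hp, p', hp', e⟩ := exists_eq_comp_normalForm h (mul_mem hP hQ)
  obtain ⟨q, hq, q', hq', e'⟩ := exists_eq_comp_normalForm h (mul_mem hQ hQ)
  have hmul : ∀ b ∈ O, ∀ v : ℂ, v ^ 2 = -(quadPoly h (b : HolQuad (chart r s t))).coeff 2 →
      (q b + v * q' b) * f b = p b + v * p' b := by
    intro b hb v hv
    rw [← e _ v hv, ← e' _ v hv, Pi.mul_apply, Pi.mul_apply]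
    by_cases h0 : Q (normalForm h b v) = 0
    · rw [h0]; ring
    · have := hPQ _ (hO b v hv hb) (by rwa [form_normalConnection])
      rw [form_normalConnection] at this
      change f (irrDet h _) = _ at this
      rw [irrDet_normalConnection] at this
      rw [this]
      field_simp
  have hqa : q a + u * q' a ≠ 0 := by
    rw [← e' _ u hu, Pi.mul_apply]
    exact mul_ne_zero hQa hQa
  -- As f takes the same value for both roots, q f = p and v q' f = v p'. One of q and u q' is
  -- nonzero at a; in the second case multiplying by v turns the relation into q₂ q' f = q₂ p'.
  by_cases h0 : q a = 0
  · rw [h0, zero_add] at hqa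
    refine ⟨(fun b => (quadPoly h b).coeff 2) * p', mul_mem (coeff_quadPoly_mem_polyFun h 2) hp',
      (fun b => (quadPoly h b).coeff 2) * q', mul_mem (coeff_quadPoly_mem_polyFun h 2) hq', ?_,
      fun b hb hqb => ?_⟩
    · refine mul_ne_zero ?_ (right_ne_zero_of_mul hqa)
      rw [← neg_ne_zero, ← hu]
      exact pow_ne_zero _ (left_ne_zero_of_mul hqa)
    · obtain ⟨v, hv⟩ := exists_sq_eq h (b : HolQuad (chart r s t))
      have h1 := hmul b hb v hv
      have h2 := hmul b hb (-v) (by rw [neg_sq, hv])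
      rw [eq_div_iff hqb]
      change f b * ((quadPoly h b).coeff 2 * q' b) = (quadPoly h b).coeff 2 * p' b
      linear_combination (-v / 2) * (h1 - h2) + (f b * q' b - p' b) * hv
  · refine ⟨p, hp, q, hq, h0, fun b hb hqb => ?_⟩
    obtain ⟨v, hv⟩ := exists_sq_eq h (b : HolQuad (chart r s t))
    have h1 := hmul b hb v hv
    have h2 := hmul b hb (-v) (by rw [neg_sq, hv])
    rw [eq_div_iff hqb]
    linear_combination (h1 + h2) / 2

theorem isOpen_nonSquares (h : ([0, 1, r, s, t] : List ℂ).Nodup) :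
    IsOpen (nonSquares (chart r s t)) := by
  refine TopologicalSpace.isOpen_generateFrom_of_mem
    ⟨(fun q => (quadPoly h q).coeff 1) ^ 2 - algebraMap ℂ _ 4 *
      (fun q => (quadPoly h q).coeff 0) * (fun q => (quadPoly h q).coeff 2), ?_,
      Set.ext fun q => by
        rw [mem_nonSquares_iff h]
        rfl⟩
  exact sub_mem (pow_mem (coeff_quadPoly_mem_polyFun h 1) 2)
    (mul_mem (mul_mem (algebraMap_mem _ _) (coeff_quadPoly_mem_polyFun h 0))
      (coeff_quadPoly_mem_polyFun h 2))

end

end GenusTwo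

end

theorem mainTheorem10 (r s t : ℂ) (hdistinct : ([0, 1, r, s, t] : List ℂ).Nodup) :
    IsOpen (GenusTwo.nonSquares (GenusTwo.chart r s t)) ∧
    ∃ Φ : GenusTwo.Moduli (GenusTwo.chart r s t) ≃ₜ GenusTwo.nonSquares (GenusTwo.chart r s t),
      (∀ D : GenusTwo.IrrConnection (GenusTwo.chart r s t),
        (Φ (GenusTwo.Moduli.mk D) : GenusTwo.HolQuad (GenusTwo.chart r s t)) = D.1.det) ∧
      ∀ (O : Set (GenusTwo.nonSquares (GenusTwo.chart r s t))), IsOpen O →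
        ∀ f : GenusTwo.nonSquares (GenusTwo.chart r s t) → ℂ,
          GenusTwo.IsRegularOn
              (Subtype.val : GenusTwo.nonSquares (GenusTwo.chart r s t) → GenusTwo.HolQuad (GenusTwo.chart r s t)) O f ↔
            GenusTwo.Moduli.IsRegularOn (Φ ⁻¹' O) (fun m => f (Φ m)) := by
  refine ⟨GenusTwo.isOpen_nonSquares hdistinct,
    (Equiv.ofBijective _ (GenusTwo.moduliDet_bijective hdistinct)).toHomeomorphOfContinuousOpen
      (GenusTwo.continuous_moduliDet hdistinct) (GenusTwo.isOpenMap_moduliDet hdistinct),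
    fun D => rfl, fun O _ f => ⟨GenusTwo.isRegularOn_moduliDet hdistinct,
      GenusTwo.isRegularOn_of_moduliDet hdistinct⟩⟩
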